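/- All manifolds are smooth, finite-dimensional, real and without boundary, and smooth means $C^\infty$. Let $G \rightrightarrows M$ be a Lie groupoid with source $s$, target $t$ and units $1_x$. Let $(\mathcal{E}, \partial)$ be a bounded $\mathbb{Z}$-graded cochain complex of smooth real vector bundles over $M$: smooth vector bundles $E^i \to M$ of constant finite rank, zero for all but finitely many $i \in \mathbb{Z}$, and smooth bundle maps $\partial^i \colon E^i \to E^{i+1}$ over $\mathrm{id}_M$ with $\partial^{i+1}\partial^i = 0$. Let $\Delta$ be a unital representation up to weak homotopy of $G$ on $(\mathcal{E}, \partial)$, that is, a family of chain maps $\Delta_g \colon (\mathcal{E}_{s(g)}, \partial) \to (\mathcal{E}_{t(g)}, \partial)$, depending smoothly on $g \in G$, such that $\Delta_g \Delta_h$ is chain homotopic to $\Delta_{gh}$ whenever $s(g) = t(h)$, and $\Delta_{1_x} = \mathrm{id}$ for all $x \in M$. Let $\mathcal{E}^{0} = \bigoplus_{i \text{ even}} E^i$ and $\mathcal{E}^{1} = \bigoplus_{i \text{ odd}} E^i$, and let $\mathrm{Ber}(\mathcal{E}) = \wedge^{\mathrm{top}} \mathcal{E}^{0} \otimes \wedge^{\mathrm{top}}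 (\mathcal{E}^{1})^*$ be the Berezinian line bundle. An invertible degree-preserving linear map $T \colon \mathcal{E}_x \to \mathcal{E}_y$ induces a linear isomorphism $\hat T \colon \mathrm{Ber}(\mathcal{E})_x \to \mathrm{Ber}(\mathcal{E})_y$, $$\hat T(e_1 \wedge \cdots \wedge e_k \otimes \xi_1 \wedge \cdots \wedge \xi_l) = T e_1 \wedge \cdots \wedge T e_k \otimes (T^*)^{-1}\xi_1 \wedge \cdots \wedge (T^*)^{-1}\xi_l .$$ **Theorem.** For every $g \in G$ there is a chain isomorphism $f \colon (\mathcal{E}_{s(g)}, \partial) \to (\mathcal{E}_{t(g)}, \partial)$ that is chain homotopic to $\Delta_g$. Moreover, there is exactly one representation $\hat\Delta$ of $G$ on the line bundle $\mathrm{Ber}(\mathcal{E})$ (linear isomorphisms $\hat\Delta_g \colon \mathrm{Ber}(\mathcal{E})_{s(g)} \to \mathrm{Ber}(\mathcal{E})_{t(g)}$, depending smoothly on $g$, with $\hat\Delta_{gh} = \hat\Delta_g \hat\Delta_h$ whenever $s(g) = t(h)$) such that $\hat\Delta_g = \hat f$ for every $g \in G$ and every chain isomorphism $f \colon (\mathcal{E}_{s(g)},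 \partial) \to (\mathcal{E}_{t(g)}, \partial)$ chain homotopic to $\Delta_g$. -/

import Mathlib

open Bundle Set Module
open scoped Manifold ContDiff Topology DirectSum TensorProduct

noncomputable section

set_option linter.unusedSectionVars false

/-! ### The Berezinian line of a graded vector space -/

namespace GradedBer

/-- The direct sum of the components whose degree satisfies `P`. For `P = Even` and `P = Odd` these
are the two components of the `ℤ/2`-graded space obtained by reducing the grading modulo `2`. -/
abbrev ParityPart (P : ℤ → Prop) (V : ℤ → Type*) [∀ i, AddCommGroup (V i)] : Type _ :=
  ⨁ i : {i : ℤ // P i}, V i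

/-- The linear isomorphism of direct sums induced by isomorphisms in every degree. -/
def ParityPart.map (P : ℤ → Prop) {V W : ℤ → Type*} [∀ i, AddCommGroup (V i)] [∀ i, Module ℝ (V i)]
    [∀ i, AddCommGroup (W i)] [∀ i, Module ℝ (W i)] (f : ∀ i, V i ≃ₗ[ℝ] W i) :
    ParityPart P V ≃ₗ[ℝ] ParityPart P W :=
  DFinsupp.mapRange.linearEquiv fun i : {i : ℤ // P i} => f i

/-- `⋀ᵏ V⁰ ⊗ ⋀ˡ (V¹)*`, where `V⁰` and `V¹` are the even and the odd part of `V`. This is the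
Berezinian line of `V` when `k = dim V⁰` and `l = dim V¹`. -/
def Ber (k l : ℕ) (V : ℤ → Type*) [∀ i, AddCommGroup (V i)] [∀ i, Module ℝ (V i)] : Type _ :=
  (⋀[ℝ]^k (ParityPart Even V)) ⊗[ℝ] (⋀[ℝ]^l (Dual ℝ (ParityPart Odd V)))

variable {V W : ℤ → Type*} [∀ i, AddCommGroup (V i)] [∀ i, Module ℝ (V i)]
  [∀ i, AddCommGroup (W i)] [∀ i, Module ℝ (W i)]
  {X : ℤ → Type*} [∀ i, AddCommGroup (X i)] [∀ i, Module ℝ (X i)]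

instance (k l : ℕ) : AddCommGroup (Ber k l V) :=
  inferInstanceAs (AddCommGroup ((⋀[ℝ]^k (ParityPart Even V)) ⊗[ℝ] (⋀[ℝ]^l (Dual ℝ (ParityPart Odd V)))))

instance (k l : ℕ) : Module ℝ (Ber k l V) :=
  inferInstanceAs (Module ℝ ((⋀[ℝ]^k (ParityPart Even V)) ⊗[ℝ] (⋀[ℝ]^l (Dual ℝ (ParityPart Odd V)))))

/-- The module topology; on a finite-dimensional real vector space it is the usual topology. -/
instance (k l : ℕ) : TopologicalSpace (Ber k l V) := moduleTopology ℝ _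

instance (k l : ℕ) : IsModuleTopology ℝ (Ber k l V) := ⟨rfl⟩

/-- The linear isomorphism of exterior powers induced by a linear isomorphism. -/
def extEquiv (n : ℕ) {A B : Type*} [AddCommGroup A] [Module ℝ A] [AddCommGroup B] [Module ℝ B]
    (e : A ≃ₗ[ℝ] B) : (⋀[ℝ]^n A) ≃ₗ[ℝ] (⋀[ℝ]^n B) :=
  LinearEquiv.ofLinearMap (exteriorPower.map n e.toLinearMap) (exteriorPower.map n e.symm.toLinearMap)
    (by rw [← exteriorPower.map_comp]; simp) (by rw [← exteriorPower.map_comp]; simp)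

/-- The map on Berezinian lines induced by an invertible degree-preserving linear map `T`:
`e₁ ∧ ⋯ ∧ e_k ⊗ ξ₁ ∧ ⋯ ∧ ξ_l ↦ T e₁ ∧ ⋯ ∧ T e_k ⊗ (T*)⁻¹ ξ₁ ∧ ⋯ ∧ (T*)⁻¹ ξ_l`. -/
def Ber.map (k l : ℕ) (T : ∀ i, V i ≃ₗ[ℝ] W i) : Ber k l V ≃ₗ[ℝ] Ber k l W :=
  TensorProduct.congr (extEquiv k (ParityPart.map Even T)) (extEquiv l (ParityPart.map Odd T).dualMap.symm)

lemma ParityPart.map_trans (P : ℤ → Prop) (f : ∀ i, V i ≃ₗ[ℝ] W i) (g : ∀ i, W i ≃ₗ[ℝ] X i) (v) :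
    ParityPart.map P (fun i => (f i).trans (g i)) v = ParityPart.map P g (ParityPart.map P f v) := by
  simp only [ParityPart.map]
  rw [DFinsupp.mapRange.linearEquiv_trans (fun i : {i : ℤ // P i} => f i) (fun i => g i)]
  rfl

lemma extEquiv_trans (n : ℕ) {A B C : Type*} [AddCommGroup A] [Module ℝ A] [AddCommGroup B]
    [Module ℝ B] [AddCommGroup C] [Module ℝ C] (e : A ≃ₗ[ℝ] B) (e' : B ≃ₗ[ℝ] C) :
    extEquiv n (e.trans e') = (extEquiv n e).trans (extEquiv n e') := by
  refine LinearEquiv.ext fun v => ?_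
  exact LinearMap.congr_fun (exteriorPower.map_comp (n := n) e.toLinearMap e'.toLinearMap) v

lemma Ber.map_trans (k l : ℕ) (f : ∀ i, V i ≃ₗ[ℝ] W i) (g : ∀ i, W i ≃ₗ[ℝ] X i) (v) :
    Ber.map k l (fun i => (f i).trans (g i)) v = Ber.map k l g (Ber.map k l f v) := by
  have h1 : ParityPart.map Even (fun i => (f i).trans (g i))
      = (ParityPart.map Even f).trans (ParityPart.map Even g) := LinearEquiv.ext fun v => ParityPart.map_trans _ f g v
  have h2 : ParityPart.map Odd (fun i => (f i).trans (g i))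
      = (ParityPart.map Odd f).trans (ParityPart.map Odd g) := LinearEquiv.ext fun v => ParityPart.map_trans _ f g v
  have h3 : ((ParityPart.map Odd f).trans (ParityPart.map Odd g)).dualMap.symm
      = (ParityPart.map Odd f).dualMap.symm.trans (ParityPart.map Odd g).dualMap.symm := rfl
  simp only [Ber.map, h1, h2, h3, extEquiv_trans, TensorProduct.congr_trans]
  rfl

lemma Ber.map_symm (k l : ℕ) (f : ∀ i, V i ≃ₗ[ℝ] W i) :
    (Ber.map k l f).symm = Ber.map k l (fun i => (f i).symm) := rfl

/-- In the top degree, an endomorphism acts on the exterior power by its determinant. -/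
lemma extMap_eq_det {A : Type*} [AddCommGroup A] [Module ℝ A] [FiniteDimensional ℝ A]
    (f : A →ₗ[ℝ] A) :
    exteriorPower.map (finrank ℝ A) f = LinearMap.det f • LinearMap.id := by
  have hd : finrank ℝ (⋀[ℝ]^(finrank ℝ A) A) = finrank ℝ ℝ := by
    rw [exteriorPower.finrank_eq, Nat.choose_self, finrank_self]
  let ψ : (⋀[ℝ]^(finrank ℝ A) A) ≃ₗ[ℝ] ℝ := LinearEquiv.ofFinrankEq _ _ hd
  let b := finBasis ℝ A
  let a : A [⋀^Fin (finrank ℝ A)]→ₗ[ℝ] ℝ :=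
    ψ.toLinearMap.compAlternatingMap (exteriorPower.ιMulti ℝ (finrank ℝ A))
  apply exteriorPower.linearMap_ext
  ext1 v
  apply ψ.injective
  have key : a (f ∘ v) = LinearMap.det f * a v := by
    rw [a.eq_smul_basis_det b]
    simp only [AlternatingMap.smul_apply, smul_eq_mul, Basis.det_comp]
    ring
  simpa [a, Function.comp_def] using key

/-- The grading `V` is concentrated in finitely many degrees. -/
class Bounded (V : ℤ → Type*) : Prop where
  exists_bound : ∃ a b : ℤ, ∀ i, i < a ∨ b < i → Subsingleton (V i)

/-- A finite set of degrees outside of which a bounded grading vanishes. -/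
def degrees (V : ℤ → Type*) [h : Bounded V] : Finset ℤ :=
  Finset.Icc h.exists_bound.choose h.exists_bound.choose_spec.choose

lemma subsingleton_of_notMem [h : Bounded V] {i : ℤ} (hi : i ∉ degrees V) : Subsingleton (V i) := by
  apply h.exists_bound.choose_spec.choose_spec
  simp only [degrees, Finset.mem_Icc, not_and_or, not_le] at hi
  exact hi

instance [Bounded V] [∀ i, FiniteDimensional ℝ (V i)] (P : ℤ → Prop) :
    FiniteDimensional ℝ (ParityPart P V) := by
  classical
  let S := {i : {i : ℤ // P i} // (i : ℤ) ∈ degrees V}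
  have : Finite S := Finite.of_injective
    (fun i : S => (⟨i.1.1, i.2⟩ : {j : ℤ // j ∈ degrees V}))
    (fun i j hij => Subtype.ext (Subtype.ext (by simpa using hij)))
  let f : ParityPart P V →ₗ[ℝ] (∀ i : S, V i.1) :=
    LinearMap.pi fun i => DirectSum.component ℝ _ (fun i : {i : ℤ // P i} => V i) i.1
  refine FiniteDimensional.of_injective f fun x y hxy => DFinsupp.ext fun i => ?_
  by_cases hi : (i : ℤ) ∈ degrees V
  · exact congrFun hxy ⟨i, hi⟩
  · exact (subsingleton_of_notMem hi).elim _ _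

/-- The Berezinian line in top degrees is one-dimensional. -/
lemma finrank_ber [Bounded V] [∀ i, FiniteDimensional ℝ (V i)] :
    finrank ℝ (Ber (finrank ℝ (ParityPart Even V)) (finrank ℝ (ParityPart Odd V)) V) = 1 := by
  have : finrank ℝ (⋀[ℝ]^(finrank ℝ (ParityPart Odd V)) (Dual ℝ (ParityPart Odd V))) = 1 := by
    rw [exteriorPower.finrank_eq, Subspace.dual_finrank_eq, Nat.choose_self]
  have h := finrank_tensorProduct (R := ℝ) (S := ℝ)
    (M := ⋀[ℝ]^(finrank ℝ (ParityPart Even V)) (ParityPart Even V))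
    (M' := ⋀[ℝ]^(finrank ℝ (ParityPart Odd V)) (Dual ℝ (ParityPart Odd V)))
  rw [this, exteriorPower.finrank_eq, Nat.choose_self] at h
  exact h

instance [Bounded V] [∀ i, FiniteDimensional ℝ (V i)] (k l : ℕ) : FiniteDimensional ℝ (Ber k l V) :=
  inferInstanceAs (FiniteDimensional ℝ
    ((⋀[ℝ]^k (ParityPart Even V)) ⊗[ℝ] (⋀[ℝ]^l (Dual ℝ (ParityPart Odd V)))))

/-- An automorphism acts on the Berezinian line by the quotient of its determinants on the even and
the odd part. -/
lemma Ber.map_eq_smul [Bounded V] [∀ i, FiniteDimensional ℝ (V i)] (f : ∀ i, V i ≃ₗ[ℝ] V i)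
    (v : Ber (finrank ℝ (ParityPart Even V)) (finrank ℝ (ParityPart Odd V)) V) :
    Ber.map _ _ f v = (LinearMap.det (ParityPart.map Even f).toLinearMap *
      LinearMap.det (ParityPart.map Odd fun i => (f i).symm).toLinearMap) • v := by
  have h1 := extMap_eq_det (ParityPart.map Even f).toLinearMap
  have h2 : exteriorPower.map (finrank ℝ (ParityPart Odd V))
      ((ParityPart.map Odd f).dualMap.symm : Dual ℝ (ParityPart Odd V) →ₗ[ℝ] Dual ℝ (ParityPart Odd V))
      = LinearMap.det (ParityPart.map Odd fun i => (f i).symm).toLinearMap • LinearMap.id := by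
    have := extMap_eq_det
      ((ParityPart.map Odd f).dualMap.symm : Dual ℝ (ParityPart Odd V) →ₗ[ℝ] Dual ℝ (ParityPart Odd V))
    rw [Subspace.dual_finrank_eq] at this
    rw [this]
    congr 1
    exact LinearMap.det_dualMap (ParityPart.map Odd fun i => (f i).symm).toLinearMap
  have h3 : Ber.map _ _ f v = TensorProduct.map
      (exteriorPower.map (finrank ℝ (ParityPart Even V)) (ParityPart.map Even f).toLinearMap)
      (exteriorPower.map (finrank ℝ (ParityPart Odd V)) ((ParityPart.map Odd f).dualMap.symm :
        Dual ℝ (ParityPart Odd V) →ₗ[ℝ] Dual ℝ (ParityPart Odd V))) v := rfl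
  rw [h1, h2, TensorProduct.map_smul_left, TensorProduct.map_smul_right, TensorProduct.map_id,
    smul_smul] at h3
  exact h3

/-- The determinant of a direct sum of endomorphisms is a polynomial in these endomorphisms. -/
lemma exists_det_formula {F : ℤ → Type*} [∀ i, NormedAddCommGroup (F i)]
    [∀ i, NormedSpace ℝ (F i)] [∀ i, FiniteDimensional ℝ (F i)] [Bounded F] (P : ℤ → Prop) :
    ∃ (n : ℕ) (φ : Fin n → Fin n → ∀ i, (F i →L[ℝ] F i) →L[ℝ] ℝ), ∀ A : ∀ i, F i ≃L[ℝ] F i,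
      LinearMap.det (ParityPart.map P fun i => (A i).toLinearEquiv).toLinearMap =
        ∑ σ : Equiv.Perm (Fin n), ((Equiv.Perm.sign σ : ℤ) : ℝ) *
          ∏ p, ∑ i ∈ degrees F, φ (σ p) p i (A i) := by
  classical
  let b := finBasis ℝ (ParityPart P F)
  let φ : Fin (finrank ℝ (ParityPart P F)) → Fin (finrank ℝ (ParityPart P F)) → ∀ i,
      (F i →L[ℝ] F i) →L[ℝ] ℝ := fun p q i =>
    if h : P i then
      (LinearMap.toContinuousLinearMap ((b.coord p) ∘ₗ
        (DirectSum.lof ℝ {i : ℤ // P i} (fun i => F i) ⟨i, h⟩))).comp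
          (ContinuousLinearMap.apply ℝ (F i) ((b q) ⟨i, h⟩))
    else 0
  refine ⟨_, φ, fun A => ?_⟩
  rw [← LinearMap.det_toMatrix b, Matrix.det_apply']
  refine Finset.sum_congr rfl fun σ _ => ?_
  congr 1
  refine Finset.prod_congr rfl fun q _ => ?_
  generalize σ q = p
  rw [LinearMap.toMatrix_apply]
  have h1 : (ParityPart.map P fun i => (A i).toLinearEquiv) (b q) =
      ∑ i ∈ degrees F, if h : P i then
        DirectSum.lof ℝ {i : ℤ // P i} (fun i => F i) ⟨i, h⟩ (A i ((b q) ⟨i, h⟩)) else 0 := by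
    refine DFinsupp.ext fun j => ?_
    have hL : (ParityPart.map P fun i => (A i).toLinearEquiv) (b q) j = A j ((b q) j) := rfl
    by_cases hj : (j : ℤ) ∈ degrees F
    · rw [hL]
      have hs : (∑ i ∈ degrees F, if h : P i then
          DirectSum.lof ℝ {i : ℤ // P i} (fun i => F i) ⟨i, h⟩ (A i ((b q) ⟨i, h⟩)) else 0) j =
          ∑ i ∈ degrees F, (if h : P i then
          DirectSum.lof ℝ {i : ℤ // P i} (fun i => F i) ⟨i, h⟩ (A i ((b q) ⟨i, h⟩)) else 0) j :=
        DFinsupp.finsetSum_apply _ _ _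
      rw [hs, Finset.sum_eq_single (j : ℤ)]
      · rw [dif_pos j.2]
        exact (DirectSum.lof_apply ℝ (M := fun i : {i : ℤ // P i} => F i) j _).symm
      · intro i _ hij
        split_ifs with h
        · exact DFinsupp.single_eq_of_ne (fun hh => hij (by rw [hh]))
        · rfl
      · exact fun h => absurd hj h
    · exact (subsingleton_of_notMem hj).elim _ _
  have h2 := congrArg (b.coord p) h1
  rw [map_sum] at h2
  refine h2.trans (Finset.sum_congr rfl fun i _ => ?_)
  by_cases h : P i
  · simp only [dif_pos h, φ]; rfl
  · simp only [dif_neg h, φ]; simp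

end GradedBer

open GradedBer

/-! ### The Berezinian line bundle of a graded vector bundle -/

/-- The fibres `⋀ᵗᵒᵖ E⁰ₓ ⊗ ⋀ᵗᵒᵖ (E¹ₓ)*` of the Berezinian bundle of the graded vector bundle `E`
with model fibres `F`, where `E⁰`, `E¹` are the sums of the even and of the odd components; their
ranks are the dimensions of the corresponding sums of the model fibres. -/
def BerBundle (F : ℤ → Type*) [∀ i, NormedAddCommGroup (F i)] [∀ i, NormedSpace ℝ (F i)]
    {M : Type*} (E : ℤ → M → Type*) [∀ i x, AddCommGroup (E i x)] [∀ i x, Module ℝ (E i x)]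
    (x : M) : Type _ :=
  Ber (finrank ℝ (ParityPart Even F)) (finrank ℝ (ParityPart Odd F)) fun i => E i x

namespace BerBundle

section

variable {F : ℤ → Type*} [∀ i, NormedAddCommGroup (F i)] [∀ i, NormedSpace ℝ (F i)]
  {M : Type*} {E : ℤ → M → Type*} [∀ i x, AddCommGroup (E i x)] [∀ i x, Module ℝ (E i x)]

instance (x : M) : AddCommGroup (BerBundle F E x) :=
  inferInstanceAs (AddCommGroup (Ber _ _ fun i => E i x))

instance (x : M) : Module ℝ (BerBundle F E x) :=
  inferInstanceAs (Module ℝ (Ber _ _ fun i => E i x))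

instance (x : M) : TopologicalSpace (BerBundle F E x) :=
  inferInstanceAs (TopologicalSpace (Ber _ _ fun i => E i x))

instance (x : M) : IsModuleTopology ℝ (BerBundle F E x) :=
  inferInstanceAs (IsModuleTopology ℝ (Ber _ _ fun i => E i x))

instance (x : M) : IsTopologicalAddGroup (BerBundle F E x) :=
  IsModuleTopology.topologicalAddGroup ℝ _

instance (x : M) : ContinuousSMul ℝ (BerBundle F E x) := IsModuleTopology.toContinuousSMul ℝ _

variable (F) in
/-- The map between fibres of the Berezinian bundle induced by an invertible degree-preserving
linear map between fibres of `E`. -/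
def map {x y : M} (T : ∀ i, E i x ≃ₗ[ℝ] E i y) : BerBundle F E x ≃ₗ[ℝ] BerBundle F E y :=
  Ber.map _ _ T

end

variable (F : ℤ → Type*) [∀ i, NormedAddCommGroup (F i)] [∀ i, NormedSpace ℝ (F i)]
  [∀ i, FiniteDimensional ℝ (F i)] [Bounded F]
  {M : Type*} [TopologicalSpace M] (E : ℤ → M → Type*)
  [∀ i x, AddCommGroup (E i x)] [∀ i x, Module ℝ (E i x)] [∀ i x, TopologicalSpace (E i x)]
  [∀ i, TopologicalSpace (TotalSpace (F i) (E i))]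
  [∀ i, FiberBundle (F i) (E i)] [∀ i, VectorBundle ℝ (F i) (E i)]

/-- An identification of the Berezinian line of the model fibre with `ℝ`. -/
def modelEquiv : Ber (finrank ℝ (ParityPart Even F)) (finrank ℝ (ParityPart Odd F)) F ≃ₗ[ℝ] ℝ :=
  LinearEquiv.ofFinrankEq _ _ (by rw [finrank_ber, finrank_self])

open Classical in
/-- The identification of `E i x` with the model fibre in the preferred trivialization at `x₀`
(and in the one at `x` if `x` is outside of the domain of the former). -/
def fibreEquiv (x₀ x : M) (i : ℤ) : E i x ≃ₗ[ℝ] F i :=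
  if h : x ∈ (trivializationAt (F i) (E i) x₀).baseSet then
    (trivializationAt (F i) (E i) x₀).linearEquivAt ℝ x h
  else (trivializationAt (F i) (E i) x).linearEquivAt ℝ x (mem_baseSet_trivializationAt (F i) (E i) x)

/-- The induced identification of the fibre of the Berezinian bundle with `ℝ`. -/
def berEquiv (x₀ x : M) : BerBundle F E x ≃ₗ[ℝ] ℝ :=
  (Ber.map _ _ (fibreEquiv F E x₀ x)).trans (modelEquiv F)

/-- The common domain of the preferred trivializations at `x₀` of the nonzero components of `E`. -/
def domain (x₀ : M) : Set M := ⋂ i ∈ degrees F, (trivializationAt (F i) (E i) x₀).baseSet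

lemma isOpen_domain (x₀ : M) : IsOpen (domain F E x₀) :=
  isOpen_biInter_finset fun i _ => (trivializationAt (F i) (E i) x₀).open_baseSet

lemma mem_domain (x₀ : M) : x₀ ∈ domain F E x₀ :=
  mem_iInter₂.2 fun i _ => mem_baseSet_trivializationAt (F i) (E i) x₀

/-- The local trivialization of the Berezinian bundle induced by those of `E`. -/
def pretriv (x₀ : M) : Pretrivialization ℝ (π ℝ (BerBundle F E)) where
  toFun p := (p.1, berEquiv F E x₀ p.1 p.2)
  invFun p := ⟨p.1, (berEquiv F E x₀ p.1).symm p.2⟩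
  source := π ℝ (BerBundle F E) ⁻¹' domain F E x₀
  target := domain F E x₀ ×ˢ univ
  map_source' _ h := ⟨h, trivial⟩
  map_target' _ h := h.1
  left_inv' p _ := by simp
  right_inv' p _ := by simp
  open_target := (isOpen_domain F E x₀).prod isOpen_univ
  baseSet := domain F E x₀
  open_baseSet := isOpen_domain F E x₀
  source_eq := rfl
  target_eq := rfl
  proj_toFun _ _ := rfl

lemma pretriv_symm (x₀ : M) {x : M} (hx : x ∈ domain F E x₀) (r : ℝ) :
    (pretriv F E x₀).symm x r = (berEquiv F E x₀ x).symm r := by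
  rw [Pretrivialization.symm_apply _ (show x ∈ (pretriv F E x₀).baseSet from hx)]
  rfl

/-- The coordinate changes of the components of `E`. -/
def change (x₀ x₁ x : M) (i : ℤ) : F i ≃L[ℝ] F i :=
  ((fibreEquiv F E x₀ x i).symm.trans (fibreEquiv F E x₁ x i)).toContinuousLinearEquiv

lemma change_eq (x₀ x₁ : M) {x : M} {i : ℤ} (h₀ : x ∈ (trivializationAt (F i) (E i) x₀).baseSet)
    (h₁ : x ∈ (trivializationAt (F i) (E i) x₁).baseSet) :
    (change F E x₀ x₁ x i : F i →L[ℝ] F i) = (trivializationAt (F i) (E i) x₀).coordChangeL ℝ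
      (trivializationAt (F i) (E i) x₁) x := by
  ext v
  rw [ContinuousLinearEquiv.coe_coe, ContinuousLinearEquiv.coe_coe,
    Trivialization.coordChangeL_apply _ _ ⟨h₀, h₁⟩]
  simp only [change, fibreEquiv, dif_pos h₀, dif_pos h₁]
  rfl

/-- The transition functions of the Berezinian bundle. -/
def transition (x₀ x₁ x : M) : ℝ :=
  LinearMap.det (ParityPart.map Even fun i => (change F E x₀ x₁ x i).toLinearEquiv).toLinearMap *
    LinearMap.det (ParityPart.map Odd fun i => (change F E x₁ x₀ x i).toLinearEquiv).toLinearMap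

lemma berEquiv_symm_berEquiv (x₀ x₁ x : M) (r : ℝ) :
    berEquiv F E x₁ x ((berEquiv F E x₀ x).symm r) = transition F E x₀ x₁ x * r := by
  have h1 : berEquiv F E x₁ x ((berEquiv F E x₀ x).symm r) = modelEquiv F (Ber.map _ _
      (fun i => (change F E x₀ x₁ x i).toLinearEquiv) ((modelEquiv F).symm r)) := by
    have := Ber.map_trans (finrank ℝ (ParityPart Even F)) (finrank ℝ (ParityPart Odd F))
      (fun i => (fibreEquiv F E x₀ x i).symm) (fibreEquiv F E x₁ x) ((modelEquiv F).symm r)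
    exact (congrArg (modelEquiv F) this).symm
  rw [h1, Ber.map_eq_smul, map_smul, LinearEquiv.apply_symm_apply]
  rfl

lemma continuousOn_transition (x₀ x₁ : M) :
    ContinuousOn (transition F E x₀ x₁) (domain F E x₀ ∩ domain F E x₁) := by
  have hc : ∀ x₀ x₁ : M, ∀ i ∈ degrees F,
      ContinuousOn (fun x => (change F E x₀ x₁ x i : F i →L[ℝ] F i))
        (domain F E x₀ ∩ domain F E x₁) := fun x₀ x₁ i hi =>
    ((continuousOn_coordChange ℝ (trivializationAt (F i) (E i) x₀)
      (trivializationAt (F i) (E i) x₁)).mono fun x hx =>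
        ⟨mem_iInter₂.1 hx.1 i hi, mem_iInter₂.1 hx.2 i hi⟩).congr fun x hx =>
          change_eq F E x₀ x₁ (mem_iInter₂.1 hx.1 i hi) (mem_iInter₂.1 hx.2 i hi)
  have hd : ∀ (P : ℤ → Prop) (x₀ x₁ : M), ContinuousOn (fun x => LinearMap.det
      (ParityPart.map P fun i => (change F E x₀ x₁ x i).toLinearEquiv).toLinearMap)
        (domain F E x₀ ∩ domain F E x₁) := by
    intro P x₀ x₁
    obtain ⟨n, φ, hφ⟩ := exists_det_formula (F := F) P
    simp only [hφ]
    refine continuousOn_finsetSum _ fun σ _ => continuousOn_const.mul ?_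
    refine continuousOn_finsetProd _ fun p _ => continuousOn_finsetSum _ fun i hi => ?_
    exact (φ (σ p) p i).continuous.comp_continuousOn (hc x₀ x₁ i hi)
  exact (hd Even x₀ x₁).mul (inter_comm (domain F E x₀) _ ▸ hd Odd x₁ x₀)

lemma contMDiffOn_transition {EM : Type*} [NormedAddCommGroup EM] [NormedSpace ℝ EM]
    [ChartedSpace EM M] [∀ i, ContMDiffVectorBundle ∞ (F i) (E i) 𝓘(ℝ, EM)] (x₀ x₁ : M) :
    ContMDiffOn 𝓘(ℝ, EM) 𝓘(ℝ) ∞ (transition F E x₀ x₁) (domain F E x₀ ∩ domain F E x₁) := by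
  have hc : ∀ x₀ x₁ : M, ∀ i ∈ degrees F,
      ContMDiffOn 𝓘(ℝ, EM) 𝓘(ℝ, F i →L[ℝ] F i) ∞
        (fun x => (change F E x₀ x₁ x i : F i →L[ℝ] F i))
        (domain F E x₀ ∩ domain F E x₁) := fun x₀ x₁ i hi =>
    ((contMDiffOn_coordChangeL (IB := 𝓘(ℝ, EM)) (n := ∞) (trivializationAt (F i) (E i) x₀)
      (trivializationAt (F i) (E i) x₁)).mono fun x hx =>
        ⟨mem_iInter₂.1 hx.1 i hi, mem_iInter₂.1 hx.2 i hi⟩).congr fun x hx =>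
          change_eq F E x₀ x₁ (mem_iInter₂.1 hx.1 i hi) (mem_iInter₂.1 hx.2 i hi)
  have hd : ∀ (P : ℤ → Prop) (x₀ x₁ : M), ContMDiffOn 𝓘(ℝ, EM) 𝓘(ℝ) ∞ (fun x => LinearMap.det
      (ParityPart.map P fun i => (change F E x₀ x₁ x i).toLinearEquiv).toLinearMap)
        (domain F E x₀ ∩ domain F E x₁) := by
    intro P x₀ x₁
    obtain ⟨n, φ, hφ⟩ := exists_det_formula (F := F) P
    simp only [hφ]
    refine contMDiffOn_finsetSum fun σ _ => contMDiffOn_const.mul ?_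
    refine contMDiffOn_finsetProd fun p _ => contMDiffOn_finsetSum fun i hi => ?_
    exact (φ (σ p) p i).contMDiff.comp_contMDiffOn (hc x₀ x₁ i hi)
  exact (hd Even x₀ x₁).mul (inter_comm (domain F E x₀) _ ▸ hd Odd x₁ x₀)

lemma transition_spec (x₀ x₁ x : M) (hx : x ∈ domain F E x₀ ∩ domain F E x₁) (r : ℝ) :
    (transition F E x₀ x₁ x • ContinuousLinearMap.id ℝ ℝ) r =
      (pretriv F E x₁ ⟨x, (pretriv F E x₀).symm x r⟩).2 := by
  rw [pretriv_symm F E x₀ hx.1]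
  exact (berEquiv_symm_berEquiv F E x₀ x₁ x r).symm

/-- The Berezinian bundle as a vector prebundle, with the local trivializations induced by `E`. -/
def prebundle : VectorPrebundle ℝ ℝ (BerBundle F E) where
  pretrivializationAtlas := range (pretriv F E)
  pretrivialization_linear' := by
    rintro _ ⟨x₀, rfl⟩
    exact ⟨fun x _ => (berEquiv F E x₀ x).toLinearMap.isLinear⟩
  pretrivializationAt := pretriv F E
  mem_base_pretrivializationAt := mem_domain F E
  pretrivialization_mem_atlas x := ⟨x, rfl⟩
  exists_coordChange := by
    rintro _ ⟨x₀, rfl⟩ _ ⟨x₁, rfl⟩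
    exact ⟨fun x => transition F E x₀ x₁ x • ContinuousLinearMap.id ℝ ℝ,
      (continuousOn_transition F E x₀ x₁).smul continuousOn_const,
      fun x hx r => transition_spec F E x₀ x₁ x hx r⟩
  totalSpaceMk_isInducing x := by
    let e : BerBundle F E x ≃L[ℝ] ℝ :=
      { berEquiv F E x x with
        continuous_toFun :=
          IsModuleTopology.continuous_of_linearMap (berEquiv F E x x).toLinearMap
        continuous_invFun :=
          IsModuleTopology.continuous_of_linearMap (berEquiv F E x x).symm.toLinearMap }
    exact Topology.isInducing_const_prod.2 e.toHomeomorph.isInducing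

instance : TopologicalSpace (TotalSpace ℝ (BerBundle F E)) := (prebundle F E).totalSpaceTopology

instance : FiberBundle ℝ (BerBundle F E) := (prebundle F E).toFiberBundle

instance : VectorBundle ℝ ℝ (BerBundle F E) := (prebundle F E).toVectorBundle

instance {EM : Type*} [NormedAddCommGroup EM] [NormedSpace ℝ EM] [ChartedSpace EM M]
    [∀ i, ContMDiffVectorBundle ∞ (F i) (E i) 𝓘(ℝ, EM)] :
    ContMDiffVectorBundle ∞ ℝ (BerBundle F E) 𝓘(ℝ, EM) := by
  have : (prebundle F E).IsContMDiff 𝓘(ℝ, EM) ∞ := ⟨by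
    rintro _ ⟨x₀, rfl⟩ _ ⟨x₁, rfl⟩
    exact ⟨fun x => transition F E x₀ x₁ x • ContinuousLinearMap.id ℝ ℝ,
      (contMDiffOn_transition F E x₀ x₁).smul contMDiffOn_const,
      fun x hx r => transition_spec F E x₀ x₁ x hx r⟩⟩
  exact (prebundle F E).contMDiffVectorBundle 𝓘(ℝ, EM)

end BerBundle

/-! ### Lie groupoids -/

/-- A Lie groupoid `G ⇉ M`. Only the values `mul g h` with `source g = target h` are relevant, and
smoothness of the multiplication is smoothness on the set of composable pairs. -/
structure LieGroupoid (EG : Type*) [NormedAddCommGroup EG] [NormedSpace ℝ EG]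
    (G : Type*) [TopologicalSpace G] [ChartedSpace EG G] [IsManifold 𝓘(ℝ, EG) ∞ G]
    (EM : Type*) [NormedAddCommGroup EM] [NormedSpace ℝ EM]
    (M : Type*) [TopologicalSpace M] [ChartedSpace EM M] [IsManifold 𝓘(ℝ, EM) ∞ M] where
  source : G → M
  target : G → M
  unit : M → G
  inv : G → G
  mul : G → G → G
  source_unit : ∀ x, source (unit x) = x
  target_unit : ∀ x, target (unit x) = x
  source_inv : ∀ g, source (inv g) = target g
  target_inv : ∀ g, target (inv g) = source g
  source_mul : ∀ g h, source g = target h → source (mul g h) = source h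
  target_mul : ∀ g h, source g = target h → target (mul g h) = target g
  mul_assoc : ∀ g h k, source g = target h → source h = target k →
    mul (mul g h) k = mul g (mul h k)
  unit_mul : ∀ g, mul (unit (target g)) g = g
  mul_unit : ∀ g, mul g (unit (source g)) = g
  inv_mul : ∀ g, mul (inv g) g = unit (source g)
  mul_inv : ∀ g, mul g (inv g) = unit (target g)
  contMDiff_source : ContMDiff 𝓘(ℝ, EG) 𝓘(ℝ, EM) ∞ source
  contMDiff_target : ContMDiff 𝓘(ℝ, EG) 𝓘(ℝ, EM) ∞ target
  submersion_source : ∀ g, Function.Surjective (mfderiv 𝓘(ℝ, EG) 𝓘(ℝ, EM) source g)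
  submersion_target : ∀ g, Function.Surjective (mfderiv 𝓘(ℝ, EG) 𝓘(ℝ, EM) target g)
  contMDiff_unit : ContMDiff 𝓘(ℝ, EM) 𝓘(ℝ, EG) ∞ unit
  contMDiff_inv : ContMDiff 𝓘(ℝ, EG) 𝓘(ℝ, EG) ∞ inv
  contMDiffOn_mul : ContMDiffOn (𝓘(ℝ, EG).prod 𝓘(ℝ, EG)) 𝓘(ℝ, EG) ∞
    (fun p : G × G => mul p.1 p.2) {p : G × G | source p.1 = target p.2}

/-- A family of linear maps `T n : V (a n) → W (b n)` between fibres of vector bundles over `M`,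
indexed by a manifold `N`, is smooth if it is so in local trivializations, that is, if it is a
smooth section of the bundle `Hom(a^* V, b^* W)` over `N`. -/
def SmoothFamily (EN : Type*) [NormedAddCommGroup EN] [NormedSpace ℝ EN]
    {N : Type*} [TopologicalSpace N] [ChartedSpace EN N]
    {M : Type*} [TopologicalSpace M] (a b : N → M)
    (F₁ : Type*) [NormedAddCommGroup F₁] [NormedSpace ℝ F₁]
    (V : M → Type*) [∀ x, AddCommGroup (V x)] [∀ x, Module ℝ (V x)] [∀ x, TopologicalSpace (V x)]
    [TopologicalSpace (TotalSpace F₁ V)] [FiberBundle F₁ V] [VectorBundle ℝ F₁ V]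
    (F₂ : Type*) [NormedAddCommGroup F₂] [NormedSpace ℝ F₂]
    (W : M → Type*) [∀ x, AddCommGroup (W x)] [∀ x, Module ℝ (W x)] [∀ x, TopologicalSpace (W x)]
    [TopologicalSpace (TotalSpace F₂ W)] [FiberBundle F₂ W] [VectorBundle ℝ F₂ W]
    (T : ∀ n, V (a n) →L[ℝ] W (b n)) : Prop :=
  ∀ n₀ : N, ContMDiffAt 𝓘(ℝ, EN) 𝓘(ℝ, F₁ →L[ℝ] F₂) ∞
    (fun n => ContinuousLinearMap.inCoordinates F₁ V F₂ W (a n₀) (a n) (b n₀) (b n) (T n)) n₀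

namespace LieGroupoid

variable {EG : Type*} [NormedAddCommGroup EG] [NormedSpace ℝ EG]
  {G : Type*} [TopologicalSpace G] [ChartedSpace EG G] [IsManifold 𝓘(ℝ, EG) ∞ G]
  {EM : Type*} [NormedAddCommGroup EM] [NormedSpace ℝ EM]
  {M : Type*} [TopologicalSpace M] [ChartedSpace EM M] [IsManifold 𝓘(ℝ, EM) ∞ M]

/-- The arrows from `x` to `y`. -/
def Hom (𝒢 : LieGroupoid EG G EM M) (x y : M) : Type _ :=
  {g : G // 𝒢.source g = x ∧ 𝒢.target g = y}

/-- An element of `G` as an arrow from its source to its target. -/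
def arrow (𝒢 : LieGroupoid EG G EM M) (g : G) : 𝒢.Hom (𝒢.source g) (𝒢.target g) := ⟨g, rfl, rfl⟩

/-- The product `g h` of `h : x ⟶ y` and `g : y ⟶ z`. -/
def comp (𝒢 : LieGroupoid EG G EM M) {x y z : M} (g : 𝒢.Hom y z) (h : 𝒢.Hom x y) : 𝒢.Hom x z :=
  ⟨𝒢.mul g.1 h.1, (𝒢.source_mul _ _ (g.2.1.trans h.2.2.symm)).trans h.2.1,
    (𝒢.target_mul _ _ (g.2.1.trans h.2.2.symm)).trans g.2.2⟩

/-- The unit `1ₓ`. -/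
def one (𝒢 : LieGroupoid EG G EM M) (x : M) : 𝒢.Hom x x :=
  ⟨𝒢.unit x, 𝒢.source_unit x, 𝒢.target_unit x⟩

/-- A representation of a Lie groupoid on a vector bundle `V`: linear isomorphisms
`Δ g : V (s g) → V (t g)`, smooth in `g`, with `Δ (g h) = Δ g ∘ Δ h` for composable `g`, `h`. -/
structure VBRepresentation (𝒢 : LieGroupoid EG G EM M)
    (F : Type*) [NormedAddCommGroup F] [NormedSpace ℝ F]
    (V : M → Type*) [∀ x, AddCommGroup (V x)] [∀ x, Module ℝ (V x)] [∀ x, TopologicalSpace (V x)]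
    [TopologicalSpace (TotalSpace F V)] [FiberBundle F V] [VectorBundle ℝ F V]
    [ContMDiffVectorBundle ∞ F V 𝓘(ℝ, EM)] where
  toFun : ∀ {x y : M}, 𝒢.Hom x y → (V x ≃L[ℝ] V y)
  smooth : SmoothFamily EG 𝒢.source 𝒢.target F V F V
    fun g => (toFun (𝒢.arrow g) : V (𝒢.source g) →L[ℝ] V (𝒢.target g))
  map_comp : ∀ {x y z : M} (g : 𝒢.Hom y z) (h : 𝒢.Hom x y) (v : V x),
    toFun (𝒢.comp g h) v = toFun g (toFun h v)

end LieGroupoid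

/-! ### Cochain complexes of vector bundles and representations up to weak homotopy -/

section Complexes

variable {V W : ℤ → Type*} [∀ i, AddCommGroup (V i)] [∀ i, Module ℝ (V i)]
  [∀ i, AddCommGroup (W i)] [∀ i, Module ℝ (W i)]

/-- `f` is a chain map between cochain complexes with differentials `dV` and `dW`. -/
def IsChainMap (dV : ∀ i, V i →ₗ[ℝ] V (i + 1)) (dW : ∀ i, W i →ₗ[ℝ] W (i + 1))
    (f : ∀ i, V i →ₗ[ℝ] W i) : Prop :=
  ∀ i, dW i ∘ₗ f i = f (i + 1) ∘ₗ dV i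

/-- `f` and `g` are chain homotopic: `f - g = d h + h d` for linear maps `h i : V (i+1) → W i`.
Every degree of the complexes is of the form `i + 1`. -/
def ChainHomotopic (dV : ∀ i, V i →ₗ[ℝ] V (i + 1)) (dW : ∀ i, W i →ₗ[ℝ] W (i + 1))
    (f g : ∀ i, V i →ₗ[ℝ] W i) : Prop :=
  ∃ h : ∀ i, V (i + 1) →ₗ[ℝ] W i,
    ∀ i, f (i + 1) - g (i + 1) = dW i ∘ₗ h i + h (i + 1) ∘ₗ dV (i + 1)

end Complexes

section

variable {EG : Type*} [NormedAddCommGroup EG] [NormedSpace ℝ EG]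
  {G : Type*} [TopologicalSpace G] [ChartedSpace EG G] [IsManifold 𝓘(ℝ, EG) ∞ G]
  {EM : Type*} [NormedAddCommGroup EM] [NormedSpace ℝ EM]
  {M : Type*} [TopologicalSpace M] [ChartedSpace EM M] [IsManifold 𝓘(ℝ, EM) ∞ M]

/-- A coboundary operator on a `ℤ`-graded vector bundle `E`, making it a cochain complex of vector
bundles: smooth bundle maps `d i : E i → E (i + 1)` with `d ∘ d = 0`. -/
structure Coboundary (EM : Type*) [NormedAddCommGroup EM] [NormedSpace ℝ EM]
    {M : Type*} [TopologicalSpace M] [ChartedSpace EM M] [IsManifold 𝓘(ℝ, EM) ∞ M]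
    (F : ℤ → Type*) [∀ i, NormedAddCommGroup (F i)] [∀ i, NormedSpace ℝ (F i)]
    (E : ℤ → M → Type*) [∀ i x, AddCommGroup (E i x)] [∀ i x, Module ℝ (E i x)]
    [∀ i x, TopologicalSpace (E i x)] [∀ i, TopologicalSpace (TotalSpace (F i) (E i))]
    [∀ i, FiberBundle (F i) (E i)] [∀ i, VectorBundle ℝ (F i) (E i)]
    [∀ i, ContMDiffVectorBundle ∞ (F i) (E i) 𝓘(ℝ, EM)] where
  d : ∀ (i : ℤ) (x : M), E i x →L[ℝ] E (i + 1) x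
  smooth : ∀ i, SmoothFamily EM id id (F i) (E i) (F (i + 1)) (E (i + 1)) (d i)
  d_comp_d : ∀ i x (v : E i x), d (i + 1) x (d i x v) = 0

variable {F : ℤ → Type*} [∀ i, NormedAddCommGroup (F i)] [∀ i, NormedSpace ℝ (F i)]
  {E : ℤ → M → Type*} [∀ i x, AddCommGroup (E i x)] [∀ i x, Module ℝ (E i x)]
  [∀ i x, TopologicalSpace (E i x)] [∀ i, TopologicalSpace (TotalSpace (F i) (E i))]
  [∀ i, FiberBundle (F i) (E i)] [∀ i, VectorBundle ℝ (F i) (E i)]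
  [∀ i, ContMDiffVectorBundle ∞ (F i) (E i) 𝓘(ℝ, EM)]

namespace Coboundary

/-- The coboundary operator of the fibre at `x`, as a family of linear maps. -/
def fibre (C : Coboundary EM F E) (x : M) (i : ℤ) : E i x →ₗ[ℝ] E (i + 1) x := (C.d i x).toLinearMap

/-- `T` is a chain map from the fibre at `x` to the fibre at `y`. -/
def IsChainMap (C : Coboundary EM F E) (x y : M) (T : ∀ i, E i x →ₗ[ℝ] E i y) : Prop :=
  _root_.IsChainMap (C.fibre x) (C.fibre y) T

/-- `S` and `T` are chain homotopic as maps from the fibre at `x` to the fibre at `y`. -/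
def ChainHomotopic (C : Coboundary EM F E) (x y : M) (S T : ∀ i, E i x →ₗ[ℝ] E i y) : Prop :=
  _root_.ChainHomotopic (C.fibre x) (C.fibre y) S T

end Coboundary

/-- A representation up to weak homotopy of a Lie groupoid on a cochain complex of vector bundles:
chain maps `Δ g` from the fibre at `s g` to the fibre at `t g`, smooth in `g`, such that `Δ g ∘ Δ h`
is chain homotopic to `Δ (g h)` for composable `g`, `h`. -/
structure RepUpToWeakHomotopy (𝒢 : LieGroupoid EG G EM M) (C : Coboundary EM F E) where
  toFun : ∀ {x y : M}, 𝒢.Hom x y → ∀ i : ℤ, E i x →L[ℝ] E i y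
  smooth : ∀ i, SmoothFamily EG 𝒢.source 𝒢.target (F i) (E i) (F i) (E i)
    fun g => toFun (𝒢.arrow g) i
  isChainMap : ∀ {x y : M} (g : 𝒢.Hom x y), C.IsChainMap x y fun i => (toFun g i).toLinearMap
  chainHomotopic : ∀ {x y z : M} (g : 𝒢.Hom y z) (h : 𝒢.Hom x y),
    C.ChainHomotopic x z (fun i => (toFun g i).toLinearMap ∘ₗ (toFun h i).toLinearMap)
      (fun i => (toFun (𝒢.comp g h) i).toLinearMap)

/-- The representation up to weak homotopy `Δ` is unital: `Δ (1ₓ) = id`. -/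
def RepUpToWeakHomotopy.Unital {𝒢 : LieGroupoid EG G EM M} {C : Coboundary EM F E}
    (Δ : RepUpToWeakHomotopy 𝒢 C) : Prop :=
  ∀ (x : M) (i : ℤ), Δ.toFun (𝒢.one x) i = ContinuousLinearMap.id ℝ (E i x)

/-- `f` is a chain isomorphism between the fibres at `x` and `y` that is chain homotopic to
`Δ g`. -/
def RepUpToWeakHomotopy.IsInvertibleReplacement {𝒢 : LieGroupoid EG G EM M}
    {C : Coboundary EM F E} (Δ : RepUpToWeakHomotopy 𝒢 C) {x y : M} (g : 𝒢.Hom x y)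
    (f : ∀ i, E i x ≃ₗ[ℝ] E i y) : Prop :=
  C.IsChainMap x y (fun i => (f i).toLinearMap) ∧
    C.ChainHomotopic x y (fun i => (Δ.toFun g i).toLinearMap) (fun i => (f i).toLinearMap)

end

end

/-! Existence of $f$. Since $\Delta_{1_x} = \mathrm{id}$, the maps $\Delta_g$ and $\Delta_{g^{-1}}$
are mutually inverse up to homotopy, and the two fibres have equal dimensions in every degree. Equal
dimensions of spaces and of cohomology force equal ranks of the differentials, by induction from the
lowest degree (`finrank_range_eq`). Adding $\partial\eta + \eta\partial$ for a suitable $\eta$ then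
makes $\Delta_g$ injective on boundaries; as it is injective on cohomology, the result is injective,
hence an isomorphism (`exists_linearEquiv_chainHomotopic`).

Independence of $f$. If $T = 1 + \partial h + h\partial$, then $T = (1 + h\partial)(1 + \partial h)$
because $\partial^2 = 0$. By the Weinstein–Aronszajn identity, $\det(1 + \partial h)$ in degree $i +
1$ equals $\gamma_i = \det(1 + h\partial)$ in degree $i$, so that $\det T^{i+1} =
\gamma_{i+1}\gamma_i$. The products over even and over odd degrees thus both equal $\prod_i
\gamma_i$, and an automorphism $T$ acts trivially on the Berezinian line (`det_even_eq_det_odd`,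
`Ber.map_eq_of_chainHomotopic`).

Hence $\hat\Delta_g = \hat f$ is well defined and unique. It is multiplicative because composites of
replacements are replacements. It is smooth because a homotopy from $\Delta_{g_0}$ to $f_0$, kept
constant in local trivializations, deforms all nearby $\Delta_g$ smoothly, and invertibility is an
open condition (`exists_smooth`). -/

noncomputable section

set_option linter.unusedSectionVars false

open GradedBer

/-! ### Determinants -/

/-- The **Weinstein–Aronszajn identity** for linear maps. -/
lemma LinearMap.det_id_add_comp_comm {A B : Type*} [AddCommGroup A] [Module ℝ A]
    [FiniteDimensional ℝ A] [AddCommGroup B] [Module ℝ B] [FiniteDimensional ℝ B]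
    (u : A →ₗ[ℝ] B) (v : B →ₗ[ℝ] A) :
    LinearMap.det (LinearMap.id + v ∘ₗ u) = LinearMap.det (LinearMap.id + u ∘ₗ v) := by
  classical
  let a := finBasis ℝ A
  let b := finBasis ℝ B
  rw [← LinearMap.det_toMatrix a, ← LinearMap.det_toMatrix b, map_add, map_add,
    LinearMap.toMatrix_comp a b a, LinearMap.toMatrix_comp b a b, LinearMap.toMatrix_id,
    LinearMap.toMatrix_id, Matrix.det_one_add_mul_comm]

/-- The determinant of a block diagonal endomorphism of a finite product. -/
lemma LinearMap.det_pi_diagonal {ι : Type*} [Fintype ι] [LinearOrder ι] {A : ι → Type*}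
    [∀ i, AddCommGroup (A i)] [∀ i, Module ℝ (A i)] [∀ i, FiniteDimensional ℝ (A i)]
    (f : ∀ i, A i →ₗ[ℝ] A i) :
    LinearMap.det (LinearMap.pi fun i => f i ∘ₗ LinearMap.proj i) =
      ∏ i, LinearMap.det (f i) := by
  let b := fun i => finBasis ℝ (A i)
  rw [← LinearMap.det_toMatrix (Pi.basis b)]
  have h : LinearMap.toMatrix (Pi.basis b) (Pi.basis b)
      (LinearMap.pi fun i => f i ∘ₗ LinearMap.proj i) =
      Matrix.blockDiagonal' fun i => LinearMap.toMatrix (b i) (b i) (f i) := by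
    ext ⟨i, p⟩ ⟨j, q⟩
    rw [LinearMap.toMatrix_apply, Pi.basis_repr, Pi.basis_apply]
    by_cases hij : i = j
    · subst hij
      simp [LinearMap.toMatrix_apply]
    · rw [Matrix.blockDiagonal'_apply_ne _ _ _ hij]
      simp [Pi.single_eq_of_ne hij]
  -- The diagonal blocks are indexed by the pairs whose first entry is `k`; `Equiv.sigmaSubtype`
  -- identifies these with the basis indices of `A k`.
  rw [h, (Matrix.blockTriangular_blockDiagonal' _).det_fintype]
  refine Finset.prod_congr rfl fun k _ => ?_
  rw [← LinearMap.det_toMatrix (b k),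
    ← Matrix.det_submatrix_equiv_self
      (Equiv.sigmaSubtype (β := fun i => Fin (finrank ℝ (A i))) k).symm]
  congr 1
  ext p q
  exact Matrix.blockDiagonal'_apply_eq (fun i => LinearMap.toMatrix (b i) (b i) (f i)) k p q

/-! ### Graded automorphisms and homotopy invariance on the Berezinian line -/

namespace GradedBer

variable {V W : ℤ → Type*} [∀ i, AddCommGroup (V i)] [∀ i, Module ℝ (V i)]
  [∀ i, AddCommGroup (W i)] [∀ i, Module ℝ (W i)]

lemma Bounded.of_equiv [h : Bounded V] (e : ∀ i, V i ≃ₗ[ℝ] W i) : Bounded W := by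
  obtain ⟨a, b, hab⟩ := h.exists_bound
  exact ⟨a, b, fun i hi => have := hab i hi; (e i).symm.toEquiv.subsingleton⟩

/-- Homotopies prescribe maps in degrees `i + 1` only, and `j - 1 + 1` is not definitionally `j`.
The transport this requires is confined to this lemma. -/
lemma exists_family_of_shift {P : ℤ → Sort*} (g : ∀ i, P (i + 1)) :
    ∃ f : ∀ j, P j, ∀ i, f (i + 1) = g i := by
  refine ⟨fun j => sub_add_cancel j 1 ▸ g (j - 1), fun i => ?_⟩
  have h : ∀ k (hk : k + 1 = i + 1), hk ▸ g k = g i := by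
    intro k hk
    obtain rfl : k = i := by omega
    rfl
  exact h _ _

/-- The determinant of a direct sum of automorphisms is the product of their determinants. -/
lemma det_parityPart_map [Bounded V] [∀ i, FiniteDimensional ℝ (V i)] (P : ℤ → Prop)
    (f : ∀ i, V i ≃ₗ[ℝ] V i) :
    LinearMap.det (ParityPart.map P f).toLinearMap =
      ∏ᶠ (i : ℤ) (_ : i ∈ {i | P i}), LinearMap.det (f i).toLinearMap := by
  classical
  -- Discarding the zero summands turns the direct sum into a finite product.
  let S := (degrees V).filter P
  let φ : ParityPart P V →ₗ[ℝ] (∀ i : S, V i) :=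
    LinearMap.pi fun i => DirectSum.component ℝ _ (fun i : {i : ℤ // P i} => V i)
      ⟨i, (Finset.mem_filter.1 i.2).2⟩
  have hinj : Function.Injective φ := fun x y hxy => DFinsupp.ext fun i => by
    by_cases hi : (i : ℤ) ∈ degrees V
    · exact congrFun hxy ⟨i, Finset.mem_filter.2 ⟨hi, i.2⟩⟩
    · exact (subsingleton_of_notMem hi).elim _ _
  have hsurj : Function.Surjective φ := fun x => by
    let y : ParityPart P V := ∑ i : S,
      DirectSum.lof ℝ {i : ℤ // P i} (fun i => V i) ⟨i, (Finset.mem_filter.1 i.2).2⟩ (x i)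
    refine ⟨y, funext fun j => ?_⟩
    rw [map_sum, Finset.sum_apply, Finset.sum_eq_single j]
    · exact DFinsupp.single_eq_same
    · intro i _ hij
      refine DFinsupp.single_eq_of_ne fun hh => hij (Subtype.ext ?_)
      exact (congrArg Subtype.val hh).symm
    · simp
  let e := LinearEquiv.ofBijective φ ⟨hinj, hsurj⟩
  have h1 : e.toLinearMap ∘ₗ (ParityPart.map P f).toLinearMap ∘ₗ e.symm.toLinearMap =
      LinearMap.pi fun i : S => (f i).toLinearMap ∘ₗ LinearMap.proj i := by
    refine LinearMap.ext fun v => ?_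
    obtain ⟨v, rfl⟩ := e.surjective v
    simp only [LinearMap.comp_apply, LinearEquiv.coe_coe, LinearEquiv.symm_apply_apply]
    rfl
  rw [← LinearMap.det_conj _ e, h1, LinearMap.det_pi_diagonal,
    Finset.prod_coe_sort S fun i => LinearMap.det (f i).toLinearMap]
  refine (finprod_mem_eq_prod_of_subset _ ?_ ?_).symm
  -- A determinant different from 1 can only occur on a nonzero space, hence in a degree of `degrees
  -- V`.
  · rintro i ⟨hi, h⟩
    refine Finset.mem_coe.2 (Finset.mem_filter.2 ⟨?_, hi⟩)
    by_contra hn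
    have := subsingleton_of_notMem hn
    exact h (LinearMap.det_eq_one_of_subsingleton _)
  · exact fun i hi => (Finset.mem_filter.1 (Finset.mem_coe.1 hi)).2

/-- A family of automorphisms that is homotopic to the identity has the same determinant on the
even and on the odd part. -/
lemma det_even_eq_det_odd [Bounded V] [∀ i, FiniteDimensional ℝ (V i)]
    (d : ∀ i, V i →ₗ[ℝ] V (i + 1)) (hd : ∀ i, d (i + 1) ∘ₗ d i = 0) (T : ∀ i, V i ≃ₗ[ℝ] V i)
    (h : ChainHomotopic d d (fun i => (T i).toLinearMap) fun _ => LinearMap.id) :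
    LinearMap.det (ParityPart.map Even T).toLinearMap =
      LinearMap.det (ParityPart.map Odd T).toLinearMap := by
  obtain ⟨h, hh⟩ := h
  let γ : ℤ → ℝ := fun i => LinearMap.det (LinearMap.id + h i ∘ₗ d i)
  have hγ : ∀ i, LinearMap.det (T (i + 1)).toLinearMap = γ (i + 1) * γ i := by
    intro i
    -- The cross term `h ∘ d ∘ d ∘ h` of the product vanishes.
    have h1 : (T (i + 1)).toLinearMap =
        (LinearMap.id + h (i + 1) ∘ₗ d (i + 1)) ∘ₗ (LinearMap.id + d i ∘ₗ h i) := by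
      have hi : (T (i + 1)).toLinearMap - LinearMap.id = _ := hh i
      rw [sub_eq_iff_eq_add.1 hi]
      ext v
      have := LinearMap.congr_fun (hd i) (h i v)
      simp only [LinearMap.comp_apply, LinearMap.zero_apply] at this
      simp only [LinearMap.add_apply, LinearMap.comp_apply, LinearMap.id_apply, map_add, this,
        map_zero]
      abel
    rw [h1, LinearMap.det_comp, ← LinearMap.det_id_add_comp_comm (d i) (h i)]
  have hsupp : (Function.mulSupport γ).Finite := (degrees V).finite_toSet.subset fun i hi => by
    by_contra hn
    have := subsingleton_of_notMem (V := V) (i := i) (by simpa using hn)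
    exact hi (LinearMap.det_eq_one_of_subsingleton _)
  have hsupp' : (Function.mulSupport fun i => γ (i - 1)).Finite :=
    hsupp.preimage (sub_left_injective (b := (1 : ℤ))).injOn
  -- The factor `γ (i - 1)` of the determinant in degree `i` is reindexed over the shifted set. The
  -- shift by one exchanges the even and the odd degrees, so for either parity the right-hand side
  -- is the product of all the `γ i`.
  have hsplit : ∀ s : Set ℤ, ∏ᶠ (i : ℤ) (_ : i ∈ s), LinearMap.det (T i).toLinearMap =
      (∏ᶠ (i : ℤ) (_ : i ∈ s), γ i) * ∏ᶠ (i : ℤ) (_ : i ∈ (fun i => i - 1) '' s), γ i := by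
    intro s
    rw [finprod_mem_image (sub_left_injective (b := (1 : ℤ))).injOn,
      ← finprod_mem_mul_distrib' (hsupp.subset inter_subset_right)
        (hsupp'.subset inter_subset_right)]
    refine finprod_mem_congr rfl fun i _ => ?_
    obtain ⟨j, rfl⟩ : ∃ j, i = j + 1 := ⟨i - 1, by ring⟩
    rw [hγ, add_sub_cancel_right]
  have he : (fun i : ℤ => i - 1) '' {i | Even i} = {i | Odd i} := by
    ext i
    refine ⟨?_, fun hi => ⟨i + 1, Odd.add_one hi, by ring⟩⟩
    rintro ⟨j, hj, rfl⟩
    exact Even.sub_odd hj odd_one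
  have ho : (fun i : ℤ => i - 1) '' {i | Odd i} = {i | Even i} := by
    ext i
    refine ⟨?_, fun hi => ⟨i + 1, Even.add_one hi, by ring⟩⟩
    rintro ⟨j, hj, rfl⟩
    exact Odd.sub_odd hj odd_one
  rw [det_parityPart_map, det_parityPart_map, hsplit, hsplit, he, ho, mul_comm]

/-- Homotopic isomorphisms of complexes induce the same map on Berezinian lines. -/
lemma Ber.map_eq_of_chainHomotopic [Bounded V] [∀ i, FiniteDimensional ℝ (V i)] {k l : ℕ}
    (hk : k = finrank ℝ (ParityPart Even V)) (hl : l = finrank ℝ (ParityPart Odd V))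
    {dV : ∀ i, V i →ₗ[ℝ] V (i + 1)} {dW : ∀ i, W i →ₗ[ℝ] W (i + 1)}
    (hdV : ∀ i, dV (i + 1) ∘ₗ dV i = 0) {f g : ∀ i, V i ≃ₗ[ℝ] W i}
    (hg : IsChainMap dV dW fun i => (g i).toLinearMap)
    (h : ChainHomotopic dV dW (fun i => (f i).toLinearMap) fun i => (g i).toLinearMap)
    (v : Ber k l V) : Ber.map k l f v = Ber.map k l g v := by
  -- `k` and `l` are kept separate in the statement because the fibres of `BerBundle` use the
  -- dimensions of the model fibre instead of those of the fibre itself.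
  subst hk hl
  obtain ⟨h, hh⟩ := h
  let T : ∀ i, V i ≃ₗ[ℝ] V i := fun i => (f i).trans (g i).symm
  have hT : ChainHomotopic dV dV (fun i => (T i).toLinearMap) fun _ => LinearMap.id := by
    refine ⟨fun i => (g i).symm.toLinearMap ∘ₗ h i, fun i => LinearMap.ext fun v => ?_⟩
    apply (g (i + 1)).injective
    have h1 := LinearMap.congr_fun (hh i) v
    have h2 := LinearMap.congr_fun (hg i) ((g i).symm (h i v))
    simp only [LinearMap.comp_apply, LinearEquiv.coe_coe, LinearEquiv.apply_symm_apply,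
      LinearMap.sub_apply, LinearMap.add_apply] at h1 h2
    simp [T, h1, h2]
  have h1 : Ber.map _ _ T v = v := by
    rw [Ber.map_eq_smul, det_even_eq_det_odd dV hdV T hT, ← LinearMap.det_comp]
    have : (ParityPart.map Odd T).toLinearMap ∘ₗ
        (ParityPart.map Odd fun i => (T i).symm).toLinearMap = LinearMap.id :=
      LinearMap.ext (ParityPart.map Odd T).apply_symm_apply
    rw [this, LinearMap.det_id, one_smul]
  have h2 := Ber.map_trans (finrank ℝ (ParityPart Even V)) (finrank ℝ (ParityPart Odd V)) f
    (fun i => (g i).symm) v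
  exact (LinearEquiv.symm_apply_eq _).1 (h2.symm.trans h1)

end GradedBer

/-! ### Chain homotopies -/

section Complexes

variable {V W X : ℤ → Type*} [∀ i, AddCommGroup (V i)] [∀ i, Module ℝ (V i)]
  [∀ i, AddCommGroup (W i)] [∀ i, Module ℝ (W i)] [∀ i, AddCommGroup (X i)] [∀ i, Module ℝ (X i)]
  {dV : ∀ i, V i →ₗ[ℝ] V (i + 1)} {dW : ∀ i, W i →ₗ[ℝ] W (i + 1)}
  {dX : ∀ i, X i →ₗ[ℝ] X (i + 1)}

lemma ChainHomotopic.symm {f g : ∀ i, V i →ₗ[ℝ] W i} (h : ChainHomotopic dV dW f g) :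
    ChainHomotopic dV dW g f := by
  obtain ⟨h, hh⟩ := h
  refine ⟨fun i => -h i, fun i => ?_⟩
  rw [← neg_sub, hh i, LinearMap.comp_neg, LinearMap.neg_comp, neg_add]

lemma ChainHomotopic.trans {f g k : ∀ i, V i →ₗ[ℝ] W i} (h : ChainHomotopic dV dW f g)
    (h' : ChainHomotopic dV dW g k) : ChainHomotopic dV dW f k := by
  obtain ⟨h, hh⟩ := h
  obtain ⟨h', hh'⟩ := h'
  refine ⟨fun i => h i + h' i, fun i => ?_⟩
  rw [← sub_add_sub_cancel, hh i, hh' i, LinearMap.comp_add, LinearMap.add_comp]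
  abel

/-- Write `f g - f' g' = f (g - g') + (f - f') g'`. Since `f` and `g'` commute with the
differentials, `f h' + h g'` is a homotopy. -/
lemma ChainHomotopic.comp {f f' : ∀ i, W i →ₗ[ℝ] X i} {g g' : ∀ i, V i →ₗ[ℝ] W i}
    (h : ChainHomotopic dW dX f f') (h' : ChainHomotopic dV dW g g')
    (hf : IsChainMap dW dX f) (hg' : IsChainMap dV dW g') :
    ChainHomotopic dV dX (fun i => f i ∘ₗ g i) fun i => f' i ∘ₗ g' i := by
  obtain ⟨h, hh⟩ := h
  obtain ⟨h', hh'⟩ := h'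
  refine ⟨fun i => f i ∘ₗ h' i + h i ∘ₗ g' (i + 1), fun i => LinearMap.ext fun v => ?_⟩
  have h1 := LinearMap.congr_fun (hh i) (g' (i + 1) v)
  have h2 := congrArg (f (i + 1)) (LinearMap.congr_fun (hh' i) v)
  have h3 := LinearMap.congr_fun (hf i) (h' i v)
  have h4 := LinearMap.congr_fun (hg' (i + 1)) v
  simp only [LinearMap.comp_apply, LinearMap.sub_apply, LinearMap.add_apply, map_add,
    map_sub] at h1 h2 h3 h4 ⊢
  rw [← sub_add_sub_cancel, h1, h2, h3, h4]
  abel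

/-- The difference `d h + h d` commutes with the differentials: either composite is `d h d`. -/
lemma IsChainMap.of_chainHomotopic {f g : ∀ i, V i →ₗ[ℝ] W i}
    (hdV : ∀ i, dV (i + 1) ∘ₗ dV i = 0) (hdW : ∀ i, dW (i + 1) ∘ₗ dW i = 0)
    (hf : IsChainMap dV dW f) (h : ChainHomotopic dV dW f g) : IsChainMap dV dW g := by
  obtain ⟨h, hh⟩ := h
  intro i
  obtain ⟨i, rfl⟩ : ∃ j, i = j + 1 := ⟨i - 1, by ring⟩
  refine LinearMap.ext fun v => ?_
  have h1 := congrArg (dW (i + 1)) (LinearMap.congr_fun (hh i) v)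
  have h2 := LinearMap.congr_fun (hh (i + 1)) (dV (i + 1) v)
  have h3 := LinearMap.congr_fun (hdV (i + 1)) v
  have h4 := LinearMap.congr_fun (hdW i) (h i v)
  have h5 := LinearMap.congr_fun (hf (i + 1)) v
  simp only [LinearMap.comp_apply, LinearMap.sub_apply, LinearMap.add_apply, map_add,
    map_sub, LinearMap.zero_apply] at h1 h2 h3 h4 h5 ⊢
  rw [h3, map_zero, add_zero] at h2
  rw [h4, zero_add, ← h2, h5] at h1
  exact sub_right_injective h1

lemma IsChainMap.comp {f : ∀ i, W i →ₗ[ℝ] X i} {g : ∀ i, V i →ₗ[ℝ] W i}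
    (hf : IsChainMap dW dX f) (hg : IsChainMap dV dW g) :
    IsChainMap dV dX fun i => f i ∘ₗ g i := fun i => by
  rw [← LinearMap.comp_assoc, hf i, LinearMap.comp_assoc, hg i, LinearMap.comp_assoc]

/-- A left homotopy invertible map is injective in cohomology. -/
lemma IsChainMap.mem_range_of_apply_mem_range {D : ∀ i, V i →ₗ[ℝ] W i} {D' : ∀ i, W i →ₗ[ℝ] V i}
    (hD' : IsChainMap dW dV D')
    (h : ChainHomotopic dV dV (fun i => D' i ∘ₗ D i) fun _ => LinearMap.id) {i : ℤ} {v : V (i + 1)}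
    (hv : dV (i + 1) v = 0) (hDv : D (i + 1) v ∈ LinearMap.range (dW i)) :
    v ∈ LinearMap.range (dV i) := by
  obtain ⟨h, hh⟩ := h
  obtain ⟨w, hw⟩ := hDv
  have h1 := LinearMap.congr_fun (hh i) v
  have h2 := LinearMap.congr_fun (hD' i) w
  simp only [LinearMap.comp_apply, LinearMap.sub_apply, LinearMap.add_apply, hv, map_zero,
    add_zero, LinearMap.id_apply, hw] at h1 h2
  -- With `D v = d w`, the element `D' D v` is both `v + d h v` and `d D' w`.
  refine ⟨D' i w - h i v, ?_⟩
  rw [map_sub, h2, ← h1]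
  abel

/-- The comparison of the dimensions of cohomologies under a left homotopy invertible map. -/
lemma finrank_ker_add_finrank_range_le [∀ i, FiniteDimensional ℝ (V i)]
    [∀ i, FiniteDimensional ℝ (W i)] (hdW : ∀ i, dW (i + 1) ∘ₗ dW i = 0)
    {D : ∀ i, V i →ₗ[ℝ] W i} {D' : ∀ i, W i →ₗ[ℝ] V i}
    (hD : IsChainMap dV dW D) (hD' : IsChainMap dW dV D')
    (h : ChainHomotopic dV dV (fun i => D' i ∘ₗ D i) fun _ => LinearMap.id) (i : ℤ) :
    finrank ℝ (LinearMap.ker (dV (i + 1))) + finrank ℝ (LinearMap.range (dW i)) ≤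
      finrank ℝ (LinearMap.ker (dW (i + 1))) + finrank ℝ (LinearMap.range (dV i)) := by
  have hBZ : LinearMap.range (dW i) ≤ LinearMap.ker (dW (i + 1)) :=
    LinearMap.range_le_ker_iff.2 (hdW i)
  -- The range of `χ` is the cohomology of `W`, and `φ` sends a cycle `v` to the class of `D v`. The
  -- kernel of `φ` consists of boundaries, so rank-nullity for `φ` and `χ` gives the inequality of
  -- cohomology dimensions, with the subtractions moved across.
  let q := (LinearMap.range (dW i)).mkQ
  let φ := (q ∘ₗ D (i + 1)).domRestrict (LinearMap.ker (dV (i + 1)))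
  let χ := q.domRestrict (LinearMap.ker (dW (i + 1)))
  have h1 : LinearMap.range φ ≤ LinearMap.range χ := by
    rintro _ ⟨v, rfl⟩
    refine ⟨⟨D (i + 1) v, ?_⟩, rfl⟩
    have := LinearMap.congr_fun (hD (i + 1)) v
    rw [LinearMap.comp_apply, LinearMap.comp_apply, v.2, map_zero] at this
    exact this
  have h2 : (LinearMap.ker φ).map (LinearMap.ker (dV (i + 1))).subtype ≤
      LinearMap.range (dV i) := by
    rintro _ ⟨v, hv, rfl⟩
    exact hD'.mem_range_of_apply_mem_range h v.2 ((Submodule.Quotient.mk_eq_zero _).1 hv)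
  have h3 : LinearMap.ker χ =
      (LinearMap.range (dW i)).comap (LinearMap.ker (dW (i + 1))).subtype := by
    ext v
    exact Submodule.Quotient.mk_eq_zero _
  have h4 := Submodule.finrank_mono h1
  have h5 := Submodule.finrank_mono h2
  rw [Submodule.finrank_map_subtype_eq] at h5
  have h6 := (Submodule.comapSubtypeEquivOfLe hBZ).finrank_eq
  rw [← h3] at h6
  have h7 := LinearMap.finrank_range_add_finrank_ker φ
  have h8 := LinearMap.finrank_range_add_finrank_ker χ
  omega

/-- Homotopy equivalent bounded complexes with the same dimensions in every degree have
differentials of the same ranks. -/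
lemma finrank_range_eq [Bounded V] [∀ i, FiniteDimensional ℝ (V i)]
    [∀ i, FiniteDimensional ℝ (W i)] (hVW : ∀ i, finrank ℝ (V i) = finrank ℝ (W i))
    (hdV : ∀ i, dV (i + 1) ∘ₗ dV i = 0) (hdW : ∀ i, dW (i + 1) ∘ₗ dW i = 0)
    {D : ∀ i, V i →ₗ[ℝ] W i} {D' : ∀ i, W i →ₗ[ℝ] V i}
    (hD : IsChainMap dV dW D) (hD' : IsChainMap dW dV D')
    (h : ChainHomotopic dV dV (fun i => D' i ∘ₗ D i) fun _ => LinearMap.id)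
    (h' : ChainHomotopic dW dW (fun i => D i ∘ₗ D' i) fun _ => LinearMap.id) (i : ℤ) :
    finrank ℝ (LinearMap.range (dV i)) = finrank ℝ (LinearMap.range (dW i)) := by
  have hV : ∀ i, _ := fun i => LinearMap.finrank_range_add_finrank_ker (dV i)
  have hW : ∀ i, _ := fun i => LinearMap.finrank_range_add_finrank_ker (dW i)
  obtain ⟨a, b, hab⟩ := Bounded.exists_bound (V := V)
  have hlow : ∀ i < a, finrank ℝ (LinearMap.range (dV i)) = finrank ℝ (LinearMap.range (dW i)) := by
    intro i hi
    have := hab i (Or.inl hi)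
    have h0 := finrank_zero_of_subsingleton (R := ℝ) (M := V i)
    have h1 := hVW i
    have h2 := hV i
    have h3 := hW i
    omega
  rcases lt_or_ge i (a - 1) with hi | hi
  · exact hlow i (by omega)
  · induction i, hi using Int.leInduction with
    | base => exact hlow _ (by omega)
    | succ i _ ih =>
      -- The two inequalities equate the cohomology dimensions in degree `i + 1`. The incoming ranks
      -- agree by induction, hence so do the kernels, and rank-nullity gives the outgoing ranks.
      have h1 := finrank_ker_add_finrank_range_le hdW hD hD' h i
      have h2 := finrank_ker_add_finrank_range_le hdV hD' hD h' i
      have h3 := hV (i + 1)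
      have h4 := hW (i + 1)
      have h5 := hVW (i + 1)
      omega

/-- A homotopy equivalence of bounded complexes with the same dimensions in every degree is
homotopic to an isomorphism. -/
lemma exists_linearEquiv_chainHomotopic [Bounded V] [∀ i, FiniteDimensional ℝ (V i)]
    [∀ i, FiniteDimensional ℝ (W i)] (hVW : ∀ i, finrank ℝ (V i) = finrank ℝ (W i))
    (hdV : ∀ i, dV (i + 1) ∘ₗ dV i = 0) (hdW : ∀ i, dW (i + 1) ∘ₗ dW i = 0)
    {D : ∀ i, V i →ₗ[ℝ] W i} {D' : ∀ i, W i →ₗ[ℝ] V i}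
    (hD : IsChainMap dV dW D) (hD' : IsChainMap dW dV D')
    (h : ChainHomotopic dV dV (fun i => D' i ∘ₗ D i) fun _ => LinearMap.id)
    (h' : ChainHomotopic dW dW (fun i => D i ∘ₗ D' i) fun _ => LinearMap.id) :
    ∃ f : ∀ i, V i ≃ₗ[ℝ] W i, ChainHomotopic dV dW D fun i => (f i).toLinearMap := by
  have hη : ∀ i, ∃ η : V (i + 1) →ₗ[ℝ] W i, ∀ v ∈ LinearMap.range (dV i),
      D (i + 1) v + dW i (η v) = 0 → v = 0 := by
    intro i
    -- The isomorphism `b` between the spaces of boundaries is arbitrary. The map `η` is chosen so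
    -- that `D + d η = b` on boundaries: it extends `σ ∘ (b - D)`, where `σ` is a section of the
    -- differential onto its range.
    let b := LinearEquiv.ofFinrankEq _ _ (finrank_range_eq hVW hdV hdW hD hD' h h' i)
    have hDr : ∀ v ∈ LinearMap.range (dV i), D (i + 1) v ∈ LinearMap.range (dW i) := by
      rintro _ ⟨v, rfl⟩
      exact ⟨D i v, LinearMap.congr_fun (hD i) v⟩
    obtain ⟨σ, hσ⟩ := (dW i).rangeRestrict.exists_rightInverse_of_surjective
      (LinearMap.range_rangeRestrict _)
    obtain ⟨η, hη⟩ := LinearMap.exists_extend (σ ∘ₗ (b.toLinearMap - (D (i + 1)).restrict hDr))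
    refine ⟨η, fun v hv h0 => ?_⟩
    have h1 : η v = σ (b ⟨v, hv⟩ - (D (i + 1)).restrict hDr ⟨v, hv⟩) :=
      LinearMap.congr_fun hη ⟨v, hv⟩
    have h2 := congrArg Subtype.val
      (LinearMap.congr_fun hσ (b ⟨v, hv⟩ - (D (i + 1)).restrict hDr ⟨v, hv⟩))
    have h3 : dW i (η v) = b ⟨v, hv⟩ - D (i + 1) v := by
      rw [h1]
      exact h2
    rw [h3, add_sub_cancel] at h0
    have h4 := b.map_eq_zero_iff.1 (Subtype.ext h0)
    exact congrArg Subtype.val h4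
  choose η hη using hη
  obtain ⟨f, hf⟩ := exists_family_of_shift (P := fun i => V i →ₗ[ℝ] W i)
    fun i => D (i + 1) + (dW i ∘ₗ η i + η (i + 1) ∘ₗ dV (i + 1))
  have hDf : ChainHomotopic dV dW f D := ⟨η, fun i => by rw [hf, add_sub_cancel_left]⟩
  have hfc : IsChainMap dV dW f := hD.of_chainHomotopic hdV hdW hDf.symm
  have hrange : ∀ i, ∀ v ∈ LinearMap.range (dV i), f (i + 1) v = 0 → v = 0 := by
    intro i v hv h0
    -- On boundaries the term `η d` of `f` vanishes, leaving `D + d η`.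
    refine hη i v hv ?_
    have : dV (i + 1) v = 0 := LinearMap.range_le_ker_iff.2 (hdV i) hv
    simpa [hf, this] using h0
  have hinj : ∀ i, Function.Injective (f i) := by
    intro i
    obtain ⟨i, rfl⟩ : ∃ j, i = j + 1 := ⟨i - 1, by ring⟩
    refine (injective_iff_map_eq_zero _).2 fun v h0 => ?_
    -- If `f v = 0`, then `f` kills the boundary `d v`, so `d v = 0`. Now `D v = d (-η v)`, so `v`
    -- is a boundary by injectivity in cohomology, and `f` is injective on boundaries.
    have h1 := LinearMap.congr_fun (hfc (i + 1)) v
    rw [LinearMap.comp_apply, LinearMap.comp_apply, h0, map_zero] at h1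
    have h2 := hrange (i + 1) _ ⟨v, rfl⟩ h1.symm
    refine hrange i v (hD'.mem_range_of_apply_mem_range h h2 ⟨-η i v, ?_⟩) h0
    simp only [hf, LinearMap.add_apply, LinearMap.comp_apply, h2, map_zero, add_zero] at h0
    rw [map_neg, neg_eq_iff_add_eq_zero]
    exact (add_comm _ _).trans h0
  exact ⟨fun i => LinearEquiv.ofInjectiveOfFinrankEq (f i) (hinj i) (hVW i), hDf.symm⟩

end Complexes

/-! ### Local expressions of maps between fibres -/

namespace BerBundle

variable (F : ℤ → Type*) [∀ i, NormedAddCommGroup (F i)] [∀ i, NormedSpace ℝ (F i)]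
  [∀ i, FiniteDimensional ℝ (F i)]
  {M : Type*} [TopologicalSpace M] (E : ℤ → M → Type*)
  [∀ i x, AddCommGroup (E i x)] [∀ i x, Module ℝ (E i x)] [∀ i x, TopologicalSpace (E i x)]
  [∀ i, TopologicalSpace (TotalSpace (F i) (E i))]
  [∀ i, FiberBundle (F i) (E i)] [∀ i, VectorBundle ℝ (F i) (E i)]

/-- The expression of a linear map between fibres in the preferred trivializations. -/
def coord (x₀ x y₀ y : M) {i j : ℤ} (T : E i x →ₗ[ℝ] E j y) : F i →L[ℝ] F j :=
  LinearMap.toContinuousLinearMap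
    ((fibreEquiv F E y₀ y j).toLinearMap ∘ₗ T ∘ₗ (fibreEquiv F E x₀ x i).symm.toLinearMap)

@[simp]
lemma coord_apply (x₀ x y₀ y : M) {i j : ℤ} (T : E i x →ₗ[ℝ] E j y) (v : F i) :
    coord F E x₀ x y₀ y T v = fibreEquiv F E y₀ y j (T ((fibreEquiv F E x₀ x i).symm v)) := rfl

/-- `coord` conjugates by `fibreEquiv`, an isomorphism at every point, so composition and
bijectivity need no condition on the base points. Only this comparison is restricted to the
trivialization domains. -/
lemma inCoordinates_eq_coord {x₀ x y₀ y : M} {i j : ℤ}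
    (hx : x ∈ (trivializationAt (F i) (E i) x₀).baseSet)
    (hy : y ∈ (trivializationAt (F j) (E j) y₀).baseSet) (T : E i x →L[ℝ] E j y) :
    ContinuousLinearMap.inCoordinates (F i) (E i) (F j) (E j) x₀ x y₀ y T =
      coord F E x₀ x y₀ y T.toLinearMap := by
  rw [ContinuousLinearMap.inCoordinates_eq hx hy]
  ext v
  simp only [coord_apply, fibreEquiv, dif_pos hx, dif_pos hy]
  rfl

lemma bijective_of_bijective_coord {x₀ x y₀ y : M} {i j : ℤ} {T : E i x →ₗ[ℝ] E j y}
    (h : Function.Bijective (coord F E x₀ x y₀ y T)) : Function.Bijective T := by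
  have hT : (T : E i x → E j y) = (fibreEquiv F E y₀ y j).symm ∘ coord F E x₀ x y₀ y T ∘
      fibreEquiv F E x₀ x i := by
    ext v
    simp
  rw [hT]
  exact (LinearEquiv.bijective _).comp (h.comp (LinearEquiv.bijective _))

/-- The expression of an isomorphism between fibres in the preferred trivializations. -/
def coordEquiv (x₀ x y₀ y : M) (f : ∀ i, E i x ≃ₗ[ℝ] E i y) (i : ℤ) : F i ≃L[ℝ] F i :=
  (((fibreEquiv F E x₀ x i).symm.trans (f i)).trans
    (fibreEquiv F E y₀ y i)).toContinuousLinearEquiv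

lemma coe_coordEquiv (x₀ x y₀ y : M) (f : ∀ i, E i x ≃ₗ[ℝ] E i y) (i : ℤ) :
    (coordEquiv F E x₀ x y₀ y f i : F i →L[ℝ] F i) = coord F E x₀ x y₀ y (f i).toLinearMap := rfl

lemma finrank_parityPart_fibre (P : ℤ → Prop) (x : M) :
    finrank ℝ (ParityPart P F) = finrank ℝ (ParityPart P fun i => E i x) :=
  (ParityPart.map P fun i => (fibreEquiv F E x x i).symm).finrank_eq

variable [Bounded F]

/-- By functoriality the trivialized map is induced by an automorphism of the model fibre, which
acts by a scalar. Smoothness on the Berezinian bundle thereby reduces to smoothness of two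
determinants. -/
lemma berEquiv_map_symm (x₀ x y₀ y : M) (f : ∀ i, E i x ≃ₗ[ℝ] E i y) (r : ℝ) :
    berEquiv F E y₀ y (map F f ((berEquiv F E x₀ x).symm r)) =
      LinearMap.det (ParityPart.map Even fun i =>
        (coordEquiv F E x₀ x y₀ y f i).toLinearEquiv).toLinearMap *
      (LinearMap.det (ParityPart.map Odd fun i =>
        (coordEquiv F E x₀ x y₀ y f i).toLinearEquiv).toLinearMap)⁻¹ * r := by
  have h1 : berEquiv F E y₀ y (map F f ((berEquiv F E x₀ x).symm r)) = modelEquiv F (Ber.map _ _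
      (fun i => (coordEquiv F E x₀ x y₀ y f i).toLinearEquiv) ((modelEquiv F).symm r)) := by
    have h2 := Ber.map_trans (finrank ℝ (ParityPart Even F)) (finrank ℝ (ParityPart Odd F))
      (fun i => (fibreEquiv F E x₀ x i).symm) f ((modelEquiv F).symm r)
    have h3 := Ber.map_trans (finrank ℝ (ParityPart Even F)) (finrank ℝ (ParityPart Odd F))
      (fun i => (fibreEquiv F E x₀ x i).symm.trans (f i)) (fibreEquiv F E y₀ y)
      ((modelEquiv F).symm r)
    rw [h2] at h3
    exact (congrArg (modelEquiv F) h3).symm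
  have h4 : LinearMap.det (ParityPart.map Odd fun i =>
        (coordEquiv F E x₀ x y₀ y f i).toLinearEquiv.symm).toLinearMap =
      (LinearMap.det (ParityPart.map Odd fun i =>
        (coordEquiv F E x₀ x y₀ y f i).toLinearEquiv).toLinearMap)⁻¹ :=
    LinearEquiv.det_coe_symm (ParityPart.map Odd fun i =>
      (coordEquiv F E x₀ x y₀ y f i).toLinearEquiv)
  rw [h1, Ber.map_eq_smul, map_smul, LinearEquiv.apply_symm_apply, h4]
  rfl

lemma inCoordinates_apply {x₀ x y₀ y : M} (hx : x ∈ domain F E x₀) (hy : y ∈ domain F E y₀)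
    (T : BerBundle F E x →L[ℝ] BerBundle F E y) (r : ℝ) :
    ContinuousLinearMap.inCoordinates ℝ (BerBundle F E) ℝ (BerBundle F E) x₀ x y₀ y T r =
      berEquiv F E y₀ y (T ((berEquiv F E x₀ x).symm r)) := by
  rw [ContinuousLinearMap.inCoordinates_eq (show x ∈ (trivializationAt ℝ (BerBundle F E) x₀).baseSet
    from hx) (show y ∈ (trivializationAt ℝ (BerBundle F E) y₀).baseSet from hy),
    ← pretriv_symm F E x₀ hx]
  rfl

/-- The map on fibres of the Berezinian bundle induced by an isomorphism, as a continuous map. -/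
def mapL {x y : M} (f : ∀ i, E i x ≃ₗ[ℝ] E i y) : BerBundle F E x ≃L[ℝ] BerBundle F E y :=
  { map F f with
    continuous_toFun := IsModuleTopology.continuous_of_linearMap (map F f).toLinearMap
    continuous_invFun := IsModuleTopology.continuous_of_linearMap (map F f).symm.toLinearMap }

/-- The determinant of a direct sum of automorphisms depends smoothly on the automorphisms. -/
lemma contMDiffAt_det {EN : Type*} [NormedAddCommGroup EN] [NormedSpace ℝ EN]
    {N : Type*} [TopologicalSpace N] [ChartedSpace EN N] {n₀ : N} (P : ℤ → Prop)
    {A : N → ∀ i, F i ≃L[ℝ] F i}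
    (hA : ∀ i, ContMDiffAt 𝓘(ℝ, EN) 𝓘(ℝ, F i →L[ℝ] F i) ∞ (fun n => (A n i : F i →L[ℝ] F i)) n₀) :
    ContMDiffAt 𝓘(ℝ, EN) 𝓘(ℝ) ∞ (fun n => LinearMap.det
      (ParityPart.map P fun i => (A n i).toLinearEquiv).toLinearMap) n₀ := by
  obtain ⟨n, φ, hφ⟩ := exists_det_formula (F := F) P
  simp only [hφ]
  refine contMDiffAt_finsetSum fun σ _ => contMDiffAt_const.mul ?_
  refine contMDiffAt_finsetProd fun p _ => contMDiffAt_finsetSum fun i hi => ?_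
  exact (φ (σ p) p i).contMDiff.contMDiffAt.comp n₀ (hA i)

/-- A family of maps between fibres of the Berezinian bundle is smooth at a point near which it is
induced by a smooth family of isomorphisms. -/
lemma contMDiffAt_inCoordinates {EN : Type*} [NormedAddCommGroup EN] [NormedSpace ℝ EN]
    {N : Type*} [TopologicalSpace N] [ChartedSpace EN N] {a b : N → M} {n₀ : N}
    (ha : ContinuousAt a n₀) (hb : ContinuousAt b n₀)
    {R : ∀ n, BerBundle F E (a n) →L[ℝ] BerBundle F E (b n)}
    {Φ : N → ∀ i, F i →L[ℝ] F i} (hΦ : ∀ i, ContMDiffAt 𝓘(ℝ, EN) 𝓘(ℝ, F i →L[ℝ] F i) ∞ (Φ · i) n₀)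
    (h : ∀ᶠ n in 𝓝 n₀, ∃ f : ∀ i, E i (a n) ≃ₗ[ℝ] E i (b n),
      (∀ i, coord F E (a n₀) (a n) (b n₀) (b n) (f i).toLinearMap = Φ n i) ∧
        ∀ v, R n v = map F f v) :
    ContMDiffAt 𝓘(ℝ, EN) 𝓘(ℝ, ℝ →L[ℝ] ℝ) ∞ (fun n => ContinuousLinearMap.inCoordinates
      ℝ (BerBundle F E) ℝ (BerBundle F E) (a n₀) (a n) (b n₀) (b n) (R n)) n₀ := by
  classical
  let Q : N → Prop := fun n => ∃ f : ∀ i, E i (a n) ≃ₗ[ℝ] E i (b n),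
      (∀ i, coord F E (a n₀) (a n) (b n₀) (b n) (f i).toLinearMap = Φ n i) ∧
        ∀ v, R n v = map F f v
  -- The isomorphisms are chosen pointwise, but near `n₀` their coordinate expressions are `Φ n`, so
  -- `A` is smooth at `n₀`. The identity is a default that keeps `A` invertible everywhere.
  let A : N → ∀ i, F i ≃L[ℝ] F i := fun n =>
    if hn : Q n then coordEquiv F E (a n₀) (a n) (b n₀) (b n) hn.choose
    else fun i => ContinuousLinearEquiv.refl ℝ (F i)
  have hA : ∀ i, ContMDiffAt 𝓘(ℝ, EN) 𝓘(ℝ, F i →L[ℝ] F i) ∞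
      (fun n => (A n i : F i →L[ℝ] F i)) n₀ := fun i =>
    (hΦ i).congr_of_eventuallyEq <| h.mono fun n hn => by
      simp only [A, dif_pos (show Q n from hn), coe_coordEquiv]
      exact hn.choose_spec.1 i
  have hid : ContMDiffAt 𝓘(ℝ, EN) 𝓘(ℝ, ℝ →L[ℝ] ℝ) ∞
      (fun _ : N => ContinuousLinearMap.id ℝ ℝ) n₀ := contMDiffAt_const
  have hdet := ((contMDiffAt_det F Even hA).mul ((contMDiffAt_det F Odd hA).inv₀
    (LinearEquiv.isUnit_det' _).ne_zero)).smul hid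
  refine hdet.congr_of_eventuallyEq ?_
  filter_upwards [h, ha ((isOpen_domain F E (a n₀)).mem_nhds (mem_domain F E (a n₀))),
    hb ((isOpen_domain F E (b n₀)).mem_nhds (mem_domain F E (b n₀)))] with n hn han hbn
  refine ContinuousLinearMap.ext fun r => ?_
  have hAn : A n = coordEquiv F E (a n₀) (a n) (b n₀) (b n) hn.choose := dif_pos hn
  rw [inCoordinates_apply F E han hbn, hn.choose_spec.2, berEquiv_map_symm, ← hAn]
  rfl

end BerBundle

/-! ### Invertible replacements -/

section

variable {EG : Type*} [NormedAddCommGroup EG] [NormedSpace ℝ EG]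
  {G : Type*} [TopologicalSpace G] [ChartedSpace EG G] [IsManifold 𝓘(ℝ, EG) ∞ G]
  {EM : Type*} [NormedAddCommGroup EM] [NormedSpace ℝ EM]
  {M : Type*} [TopologicalSpace M] [ChartedSpace EM M] [IsManifold 𝓘(ℝ, EM) ∞ M]

/-- The inverse arrow. -/
def LieGroupoid.inverse (𝒢 : LieGroupoid EG G EM M) {x y : M} (g : 𝒢.Hom x y) : 𝒢.Hom y x :=
  ⟨𝒢.inv g.1, (𝒢.source_inv _).trans g.2.2, (𝒢.target_inv _).trans g.2.1⟩

lemma LieGroupoid.inverse_comp (𝒢 : LieGroupoid EG G EM M) {x y : M} (g : 𝒢.Hom x y) :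
    𝒢.comp (𝒢.inverse g) g = 𝒢.one x :=
  Subtype.ext ((𝒢.inv_mul g.1).trans (congrArg 𝒢.unit g.2.1))

lemma LieGroupoid.comp_inverse (𝒢 : LieGroupoid EG G EM M) {x y : M} (g : 𝒢.Hom x y) :
    𝒢.comp g (𝒢.inverse g) = 𝒢.one y :=
  Subtype.ext ((𝒢.mul_inv g.1).trans (congrArg 𝒢.unit g.2.2))

variable {F : ℤ → Type*} [∀ i, NormedAddCommGroup (F i)] [∀ i, NormedSpace ℝ (F i)]
  [∀ i, FiniteDimensional ℝ (F i)] [Bounded F]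
  {E : ℤ → M → Type*} [∀ i x, AddCommGroup (E i x)] [∀ i x, Module ℝ (E i x)]
  [∀ i x, TopologicalSpace (E i x)] [∀ i, TopologicalSpace (TotalSpace (F i) (E i))]
  [∀ i, FiberBundle (F i) (E i)] [∀ i, VectorBundle ℝ (F i) (E i)]
  [∀ i, ContMDiffVectorBundle ∞ (F i) (E i) 𝓘(ℝ, EM)]
  {𝒢 : LieGroupoid EG G EM M} {C : Coboundary EM F E}

lemma Coboundary.fibre_comp_fibre (C : Coboundary EM F E) (x : M) (i : ℤ) :
    C.fibre x (i + 1) ∘ₗ C.fibre x i = 0 :=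
  LinearMap.ext (C.d_comp_d i x)

namespace RepUpToWeakHomotopy

variable {Δ : RepUpToWeakHomotopy 𝒢 C}

/-- Unitality turns the homotopies for `g⁻¹ g` and `g g⁻¹` into homotopies to the identity, so the
inverse arrow supplies a homotopy inverse. -/
lemma Unital.exists_isInvertibleReplacement (hΔ : Δ.Unital) {x y : M} (g : 𝒢.Hom x y) :
    ∃ f, Δ.IsInvertibleReplacement g f := by
  have := Bounded.of_equiv fun i => (BerBundle.fibreEquiv F E x x i).symm
  have := fun i x => (BerBundle.fibreEquiv F E x x i).symm.finiteDimensional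
  have h1 := Δ.chainHomotopic (𝒢.inverse g) g
  have h2 := Δ.chainHomotopic g (𝒢.inverse g)
  simp only [𝒢.inverse_comp, 𝒢.comp_inverse, hΔ _ _] at h1 h2
  obtain ⟨f, hf⟩ := exists_linearEquiv_chainHomotopic
    (fun i => ((BerBundle.fibreEquiv F E x x i).trans
      (BerBundle.fibreEquiv F E y y i).symm).finrank_eq) (C.fibre_comp_fibre x) (C.fibre_comp_fibre y)
    (Δ.isChainMap g) (Δ.isChainMap (𝒢.inverse g)) h1 h2
  exact ⟨f, (Δ.isChainMap g).of_chainHomotopic (C.fibre_comp_fibre x) (C.fibre_comp_fibre y) hf, hf⟩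

/-- Both isomorphisms are homotopic to `Δ g`, hence to each other. -/
lemma IsInvertibleReplacement.map_eq {x y : M} {g : 𝒢.Hom x y} {f f' : ∀ i, E i x ≃ₗ[ℝ] E i y}
    (hf : Δ.IsInvertibleReplacement g f) (hf' : Δ.IsInvertibleReplacement g f')
    (v : BerBundle F E x) : BerBundle.map F f v = BerBundle.map F f' v := by
  have := Bounded.of_equiv fun i => (BerBundle.fibreEquiv F E x x i).symm
  have := fun i => (BerBundle.fibreEquiv F E x x i).symm.finiteDimensional
  have h1 : ChainHomotopic (C.fibre x) (C.fibre y) _ _ := hf.2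
  have h2 : ChainHomotopic (C.fibre x) (C.fibre y) _ _ := hf'.2
  exact Ber.map_eq_of_chainHomotopic (BerBundle.finrank_parityPart_fibre F E Even x)
    (BerBundle.finrank_parityPart_fibre F E Odd x) (C.fibre_comp_fibre x) hf'.1 (h1.symm.trans h2) v

lemma IsInvertibleReplacement.comp {x y z : M} {g : 𝒢.Hom y z} {h : 𝒢.Hom x y}
    {f : ∀ i, E i y ≃ₗ[ℝ] E i z} {f' : ∀ i, E i x ≃ₗ[ℝ] E i y}
    (hf : Δ.IsInvertibleReplacement g f) (hf' : Δ.IsInvertibleReplacement h f') :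
    Δ.IsInvertibleReplacement (𝒢.comp g h) fun i => (f' i).trans (f i) := by
  have h1 : ChainHomotopic (C.fibre x) (C.fibre z) _ _ := Δ.chainHomotopic g h
  exact ⟨IsChainMap.comp hf.1 hf'.1,
    h1.symm.trans (ChainHomotopic.comp hf.2 hf'.2 (Δ.isChainMap g) hf'.1)⟩

/-- Near every arrow there are invertible replacements depending smoothly on the arrow. -/
lemma IsInvertibleReplacement.exists_smooth {g₀ : G}
    {f₀ : ∀ i, E i (𝒢.source g₀) ≃ₗ[ℝ] E i (𝒢.target g₀)}
    (hf₀ : Δ.IsInvertibleReplacement (𝒢.arrow g₀) f₀) :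
    ∃ Φ : G → ∀ i, F i →L[ℝ] F i,
      (∀ i, ContMDiffAt 𝓘(ℝ, EG) 𝓘(ℝ, F i →L[ℝ] F i) ∞ (Φ · i) g₀) ∧
      ∀ᶠ g in 𝓝 g₀, ∃ f : ∀ i, E i (𝒢.source g) ≃ₗ[ℝ] E i (𝒢.target g),
        (∀ i, BerBundle.coord F E (𝒢.source g₀) (𝒢.source g) (𝒢.target g₀) (𝒢.target g)
          (f i).toLinearMap = Φ g i) ∧ Δ.IsInvertibleReplacement (𝒢.arrow g) f := by
  obtain ⟨h₀, hh₀⟩ := hf₀.2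
  let s := 𝒢.source
  let t := 𝒢.target
  let eS : ∀ g i, E i (s g) ≃ₗ[ℝ] F i := fun g => BerBundle.fibreEquiv F E (s g₀) (s g)
  let eT : ∀ g i, E i (t g) ≃ₗ[ℝ] F i := fun g => BerBundle.fibreEquiv F E (t g₀) (t g)
  -- The homotopy `h₀` at `g₀` is read in the trivializations and transported unchanged to the other
  -- arrows; `T g` is `Δ g` corrected by the resulting homotopy.
  let η : ∀ i, F (i + 1) →L[ℝ] F i := fun i => BerBundle.coord F E (s g₀) (s g₀) (t g₀) (t g₀) (h₀ i)
  let h : ∀ g i, E (i + 1) (s g) →ₗ[ℝ] E i (t g) := fun g i =>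
    (eT g i).symm.toLinearMap ∘ₗ (η i).toLinearMap ∘ₗ (eS g (i + 1)).toLinearMap
  have hT : ∀ g, ∃ T : ∀ i, E i (s g) →ₗ[ℝ] E i (t g), ∀ i, T (i + 1) =
      (Δ.toFun (𝒢.arrow g) (i + 1)).toLinearMap -
        (C.fibre (t g) i ∘ₗ h g i + h g (i + 1) ∘ₗ C.fibre (s g) (i + 1)) := fun g =>
    exists_family_of_shift (P := fun i => E i (s g) →ₗ[ℝ] E i (t g)) _
  choose T hT using hT
  have hΔT : ∀ g, C.ChainHomotopic (s g) (t g)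
      (fun i => (Δ.toFun (𝒢.arrow g) i).toLinearMap) (T g) := fun g =>
    ⟨h g, fun i => by rw [hT, sub_sub_cancel]⟩
  have hTc : ∀ g, C.IsChainMap (s g) (t g) (T g) := fun g =>
    IsChainMap.of_chainHomotopic (C.fibre_comp_fibre _) (C.fibre_comp_fibre _)
      (Δ.isChainMap (𝒢.arrow g)) (hΔT g)
  let Φ : G → ∀ i, F i →L[ℝ] F i := fun g i =>
    BerBundle.coord F E (s g₀) (s g) (t g₀) (t g) (T g i)
  have hs : ContMDiffAt 𝓘(ℝ, EG) 𝓘(ℝ, EM) ∞ s g₀ := 𝒢.contMDiff_source g₀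
  have ht : ContMDiffAt 𝓘(ℝ, EG) 𝓘(ℝ, EM) ∞ t g₀ := 𝒢.contMDiff_target g₀
  have hsb : ∀ i, ∀ᶠ g in 𝓝 g₀, s g ∈ (trivializationAt (F i) (E i) (s g₀)).baseSet := fun i =>
    hs.continuousAt ((trivializationAt (F i) (E i) (s g₀)).open_baseSet.mem_nhds
      (mem_baseSet_trivializationAt (F i) (E i) (s g₀)))
  have htb : ∀ i, ∀ᶠ g in 𝓝 g₀, t g ∈ (trivializationAt (F i) (E i) (t g₀)).baseSet := fun i =>
    ht.continuousAt ((trivializationAt (F i) (E i) (t g₀)).open_baseSet.mem_nhds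
      (mem_baseSet_trivializationAt (F i) (E i) (t g₀)))
  have hΦ : ∀ i, ContMDiffAt 𝓘(ℝ, EG) 𝓘(ℝ, F i →L[ℝ] F i) ∞ (Φ · i) g₀ := by
    intro i
    obtain ⟨i, rfl⟩ : ∃ j, i = j + 1 := ⟨i - 1, by ring⟩
    have h1 := Δ.smooth (i + 1) g₀
    have h2 := ContMDiffAt.comp g₀ (C.smooth i (t g₀)) ht
    have h3 := ContMDiffAt.comp g₀ (C.smooth (i + 1) (s g₀)) hs
    have h4 := h1.sub ((h2.clm_comp (contMDiffAt_const (c := η i))).add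
      ((contMDiffAt_const (c := η (i + 1))).clm_comp h3))
    refine h4.congr_of_eventuallyEq ?_
    filter_upwards [hsb (i + 1), hsb (i + 1 + 1), htb i, htb (i + 1)] with g g1 g2 g3 g4
    refine ContinuousLinearMap.ext fun v => ?_
    have e1 := BerBundle.inCoordinates_eq_coord F E g1 g4 (Δ.toFun (𝒢.arrow g) (i + 1))
    have e2 := BerBundle.inCoordinates_eq_coord F E g3 g4 (C.d i (t g))
    have e3 := BerBundle.inCoordinates_eq_coord F E g1 g2 (C.d (i + 1) (s g))
    simp only [Φ, hT, Function.comp_apply, id, s, t] at e1 e2 e3 ⊢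
    simp [e1, e2, e3, h, eS, eT, s, t, Coboundary.fibre]
  refine ⟨Φ, hΦ, ?_⟩
  -- At `g₀` the transported homotopy is `h₀` itself, so the correction returns `f₀`.
  have hT₀ : ∀ i, T g₀ i = (f₀ i).toLinearMap := by
    intro i
    obtain ⟨i, rfl⟩ : ∃ j, i = j + 1 := ⟨i - 1, by ring⟩
    have h1 : ∀ i, h g₀ i = h₀ i := fun i => by
      ext v
      simp [h, η, eS, eT]
    rw [hT, h1, h1, sub_eq_iff_eq_add, ← sub_eq_iff_eq_add']
    exact hh₀ i
  -- Only finitely many degrees impose a condition, so the neighbourhoods can be intersected; in the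
  -- others the model fibre is zero.
  have hunit : ∀ i ∈ degrees F, ∀ᶠ g in 𝓝 g₀, IsUnit (Φ g i) := by
    intro i _
    have : CompleteSpace (F i) := FiniteDimensional.complete ℝ _
    refine (hΦ i).continuousAt (Units.isOpen.mem_nhds ?_)
    refine ContinuousLinearMap.isUnit_iff_bijective.2 ?_
    have h1 : Φ g₀ i = BerBundle.coordEquiv F E (s g₀) (s g₀) (t g₀) (t g₀) f₀ i := by
      simp only [Φ, hT₀]
      rfl
    rw [h1]
    exact (BerBundle.coordEquiv F E (s g₀) (s g₀) (t g₀) (t g₀) f₀ i).bijective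
  filter_upwards [(Filter.eventually_all_finset _).2 hunit] with g hg
  have hbij : ∀ i, Function.Bijective (T g i) := by
    intro i
    refine BerBundle.bijective_of_bijective_coord F E (x₀ := s g₀) (y₀ := t g₀) ?_
    by_cases hi : i ∈ degrees F
    · exact ContinuousLinearMap.isUnit_iff_bijective.1 (hg i hi)
    · have := subsingleton_of_notMem hi
      exact ⟨Function.injective_of_subsingleton _, Function.surjective_to_subsingleton _⟩
  exact ⟨fun i => LinearEquiv.ofBijective (T g i) (hbij i), fun i => rfl, hTc g, hΔT g⟩

/-- The representation on the Berezinian bundle induced by a unital representation up to weak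
homotopy. -/
def berRepresentation (hΔ : Δ.Unital) : 𝒢.VBRepresentation ℝ (BerBundle F E) where
  toFun g := BerBundle.mapL F E (hΔ.exists_isInvertibleReplacement g).choose
  smooth g₀ := by
    obtain ⟨f₀, hf₀⟩ := hΔ.exists_isInvertibleReplacement (𝒢.arrow g₀)
    obtain ⟨Φ, hΦ, h⟩ := hf₀.exists_smooth
    refine BerBundle.contMDiffAt_inCoordinates F E 𝒢.contMDiff_source.continuous.continuousAt
      𝒢.contMDiff_target.continuous.continuousAt hΦ (h.mono ?_)
    rintro g ⟨f, hf, hgf⟩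
    -- The replacement chosen in `toFun` need not vary smoothly, but it induces the same Berezinian
    -- map as the smooth local one.
    exact ⟨f, hf, (hΔ.exists_isInvertibleReplacement (𝒢.arrow g)).choose_spec.map_eq hgf⟩
  map_comp g h v := by
    have h1 := (hΔ.exists_isInvertibleReplacement (𝒢.comp g h)).choose_spec.map_eq
      ((hΔ.exists_isInvertibleReplacement g).choose_spec.comp
        (hΔ.exists_isInvertibleReplacement h).choose_spec) v
    exact h1.trans (Ber.map_trans _ _ _ _ v)

lemma berRepresentation_apply (hΔ : Δ.Unital) {x y : M} {g : 𝒢.Hom x y}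
    {f : ∀ i, E i x ≃ₗ[ℝ] E i y} (hf : Δ.IsInvertibleReplacement g f) (v : BerBundle F E x) :
    (berRepresentation hΔ).toFun g v = BerBundle.map F f v :=
  (hΔ.exists_isInvertibleReplacement g).choose_spec.map_eq hf v

end RepUpToWeakHomotopy

end

end

/-! ### Existence and uniqueness of the Berezinian representation -/

theorem mainTheorem1
    {EG : Type*} [NormedAddCommGroup EG] [NormedSpace ℝ EG] [FiniteDimensional ℝ EG]
    {G : Type*} [TopologicalSpace G] [ChartedSpace EG G] [IsManifold 𝓘(ℝ, EG) ∞ G]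
    {EM : Type*} [NormedAddCommGroup EM] [NormedSpace ℝ EM] [FiniteDimensional ℝ EM]
    {M : Type*} [TopologicalSpace M] [ChartedSpace EM M] [IsManifold 𝓘(ℝ, EM) ∞ M]
    (𝒢 : LieGroupoid EG G EM M)
    {F : ℤ → Type*} [∀ i, NormedAddCommGroup (F i)] [∀ i, NormedSpace ℝ (F i)]
    [∀ i, FiniteDimensional ℝ (F i)] [GradedBer.Bounded F]
    {E : ℤ → M → Type*} [∀ i x, AddCommGroup (E i x)] [∀ i x, Module ℝ (E i x)]
    [∀ i x, TopologicalSpace (E i x)] [∀ i, TopologicalSpace (TotalSpace (F i) (E i))]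
    [∀ i, FiberBundle (F i) (E i)] [∀ i, VectorBundle ℝ (F i) (E i)]
    [∀ i, ContMDiffVectorBundle ∞ (F i) (E i) 𝓘(ℝ, EM)]
    (C : Coboundary EM F E) (Δ : RepUpToWeakHomotopy 𝒢 C) (hΔ : Δ.Unital) :
    (∀ {x y : M} (g : 𝒢.Hom x y), ∃ f, Δ.IsInvertibleReplacement g f) ∧
    ∃! R : 𝒢.VBRepresentation ℝ (BerBundle F E),
      ∀ {x y : M} (g : 𝒢.Hom x y) (f : ∀ i, E i x ≃ₗ[ℝ] E i y), Δ.IsInvertibleReplacement g f →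
        ∀ v : BerBundle F E x, R.toFun g v = BerBundle.map F f v := by
  refine ⟨fun g => hΔ.exists_isInvertibleReplacement g,
    RepUpToWeakHomotopy.berRepresentation hΔ,
    fun g f hf v => RepUpToWeakHomotopy.berRepresentation_apply hΔ hf v, ?_⟩
  intro R hR
  -- Every arrow has a replacement, which determines `R` on it. The remaining fields of a
  -- representation are propositions.
  have h : @R.toFun = @(RepUpToWeakHomotopy.berRepresentation hΔ).toFun := by
    funext x y g
    obtain ⟨f, hf⟩ := hΔ.exists_isInvertibleReplacement g
    refine ContinuousLinearEquiv.ext (funext fun v => ?_)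
    rw [hR g f hf v, RepUpToWeakHomotopy.berRepresentation_apply hΔ hf v]
  cases R
  simp only at h
  subst h
  rfl
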